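/- A square is a nondegenerate, arbitrarily rotated square in $\mathbb{R}^2$, identified with its open interior. Let $C\subset\mathbb{R}^2$ (the cake) be a compact set containing at least one square, and let $n\ge 1$ be an integer. A value measure on $C$ is a measure $V(X)=\iint_X v(x,y)\,dx\,dy$ whose density $v$ is integrable, nonnegative and bounded on $C$; its square-utility of the cake is $V^{S}(C)=\sup\{V(s): s\subseteq C \text{ a square}\}$. The relative proportionality level $\mathrm{PropRel}(C,n,\mathrm{Squares})$ is the largest $f\in[0,1]$ (the supremum of those $f$) such that for all value measures $V_1,\dots,V_n$ on $C$ there are pairwise disjoint squares $X_1,\dots,X_n\subseteq C$ with $V_i(X_i)\ge f\cdot V_i^{S}(C)$ for every $i$. Then $$\mathrm{PropRel}(C,n,\mathrm{Squares})\ \ge\ \frac{1}{16n-14},$$ and the fraction $\frac1{16n-14}$ is itself guaranteed: for all value measures $V_1,\dots,V_n$ on $C$ there are pairwise disjoint squares $X_1,\dots,X_n\subseteq C$ with $V_i(X_i)\ge \frac{1}{16n-14}\,V_i^{S}(C)$ for every $i$. -/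

import Mathlib

noncomputable section

namespace CakeCutting

open MeasureTheory

/-- The Euclidean plane. -/
abbrev Plane : Type := EuclideanSpace ℝ (Fin 2)

/-- The open square with a corner at `p` and side length `a` whose two sides at `p` point in the
directions `(cos θ, sin θ)` and `(-sin θ, cos θ)`. -/
def openSquare (p : Plane) (a θ : ℝ) : Set Plane :=
  {x | ∃ s ∈ Set.Ioo 0 a, ∃ t ∈ Set.Ioo 0 a,
    x = p + s • !₂[Real.cos θ, Real.sin θ] + t • !₂[-Real.sin θ, Real.cos θ]}

/-- The family of all (arbitrarily rotated, nondegenerate) squares. The boundary of a square has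
area zero and hence no value to any agent, so a square is represented by its interior; thus
disjointness of pieces means that the squares do not overlap. -/
def squares : Set (Set Plane) :=
  {X | ∃ (p : Plane) (a θ : ℝ), 0 < a ∧ X = openSquare p a θ}

/-- A value-density function on the cake `C`: integrable, nonnegative and bounded on `C`, and
nonzero only in a bounded subset of `C` (the last is automatic when `C` is bounded). -/
structure IsValueDensity (C : Set Plane) (v : Plane → ℝ) : Prop where
  integrableOn : IntegrableOn v C volume
  nonneg : ∀ x ∈ C, 0 ≤ v x
  bounded : ∃ M : ℝ, ∀ x ∈ C, v x ≤ M
  support_bounded : Bornology.IsBounded {x ∈ C | v x ≠ 0}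

/-- The value of the piece `X` to an agent with value density `v`. -/
def value (v : Plane → ℝ) (X : Set Plane) : ℝ := ∫ x in X, v x

/-- The utility of the piece `X`: the supremum of the values of the usable pieces in `X`. -/
def utility (S : Set (Set Plane)) (v : Plane → ℝ) (X : Set Plane) : ℝ :=
  sSup {r | ∃ s ∈ S, s ⊆ X ∧ r = value v s}

/-- An `S`-allocation of the cake `C` to `n` agents: pairwise disjoint usable pieces of `C`, one
per agent. Some of the cake may remain unallocated. -/
structure IsAllocation (C : Set Plane) (n : ℕ) (S : Set (Set Plane))
    (X : Fin n → Set Plane) : Prop where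
  mem : ∀ i, X i ∈ S
  subset : ∀ i, X i ⊆ C
  disjoint : Pairwise fun i j => Disjoint (X i) (X j)

/-- The fraction `f` can be guaranteed to `n` agents relative to their utilities of the cake: for
all value measures there is an `S`-allocation with `V i (X i) / V i ^ S (C) ≥ f` for each agent `i`.
The inequality is written without division, so that it also makes sense for an agent who has
utility zero for the cake. -/
def IsGuaranteedRel (C : Set Plane) (n : ℕ) (S : Set (Set Plane)) (f : ℝ) : Prop :=
  ∀ v : Fin n → Plane → ℝ, (∀ i, IsValueDensity C (v i)) →
    ∃ X : Fin n → Set Plane, IsAllocation C n S X ∧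
      ∀ i, f * utility S (v i) C ≤ value (v i) (X i)

/-- The relative proportionality level of `C`, `n` and `S`: the largest (more precisely, the
supremum of the) fractions in `[0, 1]` that can be guaranteed. -/
def propRel (C : Set Plane) (n : ℕ) (S : Set (Set Plane)) : ℝ :=
  sSup {f | f ∈ Set.Icc (0 : ℝ) 1 ∧ IsGuaranteedRel C n S f}

end CakeCutting

end

/-!
The allocation is found greedily. Fix a threshold `t j` for each agent. As long as agents are
waiting, consider all squares in the remaining cake whose value is at least `t j` for some waiting
agent `j`; give one of least side length, which exists by compactness, to that agent. What has to
be shown is that a waiting agent `j`, for whom some square `S ⊆ C` has value more than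
`(16 * n - 14) * t j`, never runs out of acceptable squares. After `k ≤ n - 1` squares have been cut
there are two facts to combine.

* Piercing (`exists_pierce_margin`). A square `X`, in whatever position, comes with eight points,
  called sites, such that each larger square parallel to `S` that meets `X` contains one of them.
* Covering (`exists_cover`). If `M` points in general position are removed from a square, then the
  rest is covered by `2 * M + 2` parallel squares that contain none of the points in their
  interiors.

With the `8 * k` sites of the squares cut so far, slightly moved into general position, some square
`P` of the cover has at least the fraction `1 / (16 * k + 2) ≥ 1 / (16 * n - 14)` of the value of `S`
and contains no site; so it meets none of the cut squares that are smaller than itself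
(`exists_square_avoiding_smaller`). But no cut square `X` is as large as `P`: going through the cut
squares in order, `P` is disjoint from those cut before `X`, so it was available when `X` was cut,
and `X` had least side length. Hence `P` is disjoint from all of them
(`IsChain.exists_available`). Thresholds with `(16 * n - 14) * t j` equal to the utility of agent `j`
are reached as a limit, because the allocations form a compact set (`exists_allocation_limit`).

For the covering, take for each point a largest free square containing it. It is blocked on two
opposite sides and may be slid along them until a third side is blocked, by a site or a wall. In
general position such tight squares are determined by one of their sites, together with the choice
of above or below, except for two squares in the corners on the left: this is the count
`2 * M + 2` (`IsTight.isAttributed`, `IsUp.unique`, `IsTopLeft.unique`).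
-/

namespace CakeCutting

open MeasureTheory Filter Topology

section

variable {Z : Set (ℝ × ℝ)} {L u v a b s : ℝ}

/-! ### Covering a punctured square by free squares -/

/-- The square `[a, a + s] × [b, b + s]` lies in `[0, L] × [0, L]` and its interior contains no
point of `Z`. The points of `Z` are called sites, and the sides of `[0, L] × [0, L]` walls. -/
def IsFree (Z : Set (ℝ × ℝ)) (L a b s : ℝ) : Prop :=
  0 ≤ a ∧ 0 ≤ b ∧ a + s ≤ L ∧ b + s ≤ L ∧
    ∀ z ∈ Z, ¬ (a < z.1 ∧ z.1 < a + s ∧ b < z.2 ∧ z.2 < b + s)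

/-- The left side of the square lies on the left wall, or contains a site in its relative
interior. -/
def TouchL (Z : Set (ℝ × ℝ)) (a b s : ℝ) : Prop :=
  a = 0 ∨ ∃ z ∈ Z, z.1 = a ∧ b < z.2 ∧ z.2 < b + s

/-- The right side of the square lies on the right wall, or contains a site in its relative
interior. -/
def TouchR (Z : Set (ℝ × ℝ)) (L a b s : ℝ) : Prop :=
  a + s = L ∨ ∃ z ∈ Z, z.1 = a + s ∧ b < z.2 ∧ z.2 < b + s

/-- The bottom side of the square lies on the bottom wall, or contains a site in its relative
interior. -/
def TouchB (Z : Set (ℝ × ℝ)) (a b s : ℝ) : Prop :=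
  b = 0 ∨ ∃ z ∈ Z, z.2 = b ∧ a < z.1 ∧ z.1 < a + s

/-- The top side of the square lies on the top wall, or contains a site in its relative
interior. -/
def TouchT (Z : Set (ℝ × ℝ)) (L a b s : ℝ) : Prop :=
  b + s = L ∨ ∃ z ∈ Z, z.2 = b + s ∧ a < z.1 ∧ z.1 < a + s

/-- General position for a set of sites in the square with side length `L`: no two sites share a
coordinate, and no positive difference of first coordinates equals a difference of second
coordinates. The coordinates `0` and `L` of the walls are included, so the difference `L` has to be
excepted. -/
structure IsGeneric (Z : Set (ℝ × ℝ)) (L : ℝ) : Prop where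
  fst_inj : ∀ z ∈ Z, ∀ w ∈ Z, z.1 = w.1 → z = w
  snd_inj : ∀ z ∈ Z, ∀ w ∈ Z, z.2 = w.2 → z = w
  diff : ∀ x ∈ insert 0 (insert L (Prod.fst '' Z)), ∀ x' ∈ insert 0 (insert L (Prod.fst '' Z)),
    ∀ y ∈ insert 0 (insert L (Prod.snd '' Z)), ∀ y' ∈ insert 0 (insert L (Prod.snd '' Z)),
      x - x' = y - y' → 0 < x - x' → x - x' = L

/-- The square is a largest free square among those containing the point `(u, v)`. -/
def IsLargestAt (Z : Set (ℝ × ℝ)) (L u v a b s : ℝ) : Prop :=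
  IsFree Z L a b s ∧ (a ≤ u ∧ u ≤ a + s ∧ b ≤ v ∧ v ≤ b + s) ∧
    ∀ a' b' s', IsFree Z L a' b' s' → a' ≤ u ∧ u ≤ a' + s' ∧ b' ≤ v ∧ v ≤ b' + s' → s' ≤ s

lemma IsGeneric.swap (h : IsGeneric Z L) : IsGeneric (Prod.swap ⁻¹' Z) L := by
  have e1 : Prod.fst '' (Prod.swap ⁻¹' Z) = Prod.snd '' Z := by
    ext x; constructor
    · rintro ⟨z, hz, rfl⟩; exact ⟨z.swap, hz, rfl⟩
    · rintro ⟨z, hz, rfl⟩; exact ⟨z.swap, by simpa using hz, rfl⟩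
  have e2 : Prod.snd '' (Prod.swap ⁻¹' Z) = Prod.fst '' Z := by
    ext x; constructor
    · rintro ⟨z, hz, rfl⟩; exact ⟨z.swap, hz, rfl⟩
    · rintro ⟨z, hz, rfl⟩; exact ⟨z.swap, by simpa using hz, rfl⟩
  refine ⟨fun z hz w hw e => ?_, fun z hz w hw e => ?_, ?_⟩
  · exact Prod.swap_injective (h.snd_inj _ hz _ hw e)
  · exact Prod.swap_injective (h.fst_inj _ hz _ hw e)
  · rw [e1, e2]
    intro x hx x' hx' y hy y' hy' e hp
    rw [e]
    exact h.diff y hy y' hy' x hx x' hx' e.symm (e ▸ hp)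

lemma IsFree.swap (h : IsFree Z L a b s) : IsFree (Prod.swap ⁻¹' Z) L b a s := by
  obtain ⟨h1, h2, h3, h4, h5⟩ := h
  refine ⟨h2, h1, h4, h3, fun z hz hh => h5 _ hz ?_⟩
  simp only [Prod.fst_swap, Prod.snd_swap]
  tauto

lemma touchL_swap (h : TouchL (Prod.swap ⁻¹' Z) a b s) : TouchB Z b a s := by
  rcases h with h | ⟨z, hz, h⟩
  · exact Or.inl h
  · exact Or.inr ⟨z.swap, hz, h⟩

lemma touchR_swap (h : TouchR (Prod.swap ⁻¹' Z) L a b s) : TouchT Z L b a s := by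
  rcases h with h | ⟨z, hz, h⟩
  · exact Or.inl h
  · exact Or.inr ⟨z.swap, hz, h⟩

lemma touchB_swap (h : TouchB (Prod.swap ⁻¹' Z) a b s) : TouchL Z b a s := by
  rcases h with h | ⟨z, hz, h⟩
  · exact Or.inl h
  · exact Or.inr ⟨z.swap, hz, h⟩

lemma touchT_swap (h : TouchT (Prod.swap ⁻¹' Z) L a b s) : TouchR Z L b a s := by
  rcases h with h | ⟨z, hz, h⟩
  · exact Or.inl h
  · exact Or.inr ⟨z.swap, hz, h⟩

lemma IsLargestAt.swap (h : IsLargestAt Z L u v a b s) :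
    IsLargestAt (Prod.swap ⁻¹' Z) L v u b a s := by
  obtain ⟨h1, h2, h3⟩ := h
  refine ⟨h1.swap, by tauto, fun a' b' s' hf hm => h3 b' a' s' ?_ (by tauto)⟩
  have := hf.swap
  rwa [← Set.preimage_comp, Prod.swap_swap_eq, Set.preimage_id] at this

lemma eventually_add_mul_lt {c d : ℝ} (k : ℝ) (h : c < d) :
    ∀ᶠ ε in 𝓝[>] (0 : ℝ), c + k * ε < d := by
  have : Tendsto (fun ε : ℝ => c + k * ε) (𝓝 0) (𝓝 (c + k * 0)) :=
    (Continuous.tendsto (by fun_prop) 0)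
  rw [mul_zero, add_zero] at this
  exact (this.eventually_lt_const h).filter_mono nhdsWithin_le_nhds

/-- A largest free square cannot be enlarged, whichever way the growth is distributed among its
sides. -/
lemma IsLargestAt.not_grow (h : IsLargestAt Z L u v a b s) {k l : ℝ} (hk0 : 0 ≤ k) (hk1 : k ≤ 1)
    (hl0 : 0 ≤ l) (hl1 : l ≤ 1) :
    ¬ ∀ᶠ ε in 𝓝[>] (0 : ℝ), IsFree Z L (a - k * ε) (b - l * ε) (s + ε) := by
  intro hev
  obtain ⟨ε, hε, hpos⟩ := (hev.and self_mem_nhdsWithin).exists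
  have hpos : 0 < ε := hpos
  obtain ⟨-, ⟨h1, h2, h3, h4⟩, hmax⟩ := h
  have := hmax _ _ _ hε ⟨by nlinarith, by nlinarith, by nlinarith, by nlinarith⟩
  linarith

/-- Growth away from the bottom left corner is stopped by a wall or by a site, which may be the top
right corner of the square. The other three corners behave in the same way. -/
lemma IsLargestAt.blocked_NE (h : IsLargestAt Z L u v a b s) (hZ : Z.Finite) :
    a + s = L ∨ b + s = L ∨ ∃ z ∈ Z, a < z.1 ∧ z.1 ≤ a + s ∧ b < z.2 ∧ z.2 ≤ b + s := by
  by_contra! hc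
  obtain ⟨c1, c2, c3⟩ := hc
  obtain ⟨f1, f2, f3, f4, f5⟩ := h.1
  refine h.not_grow (k := 0) (l := 0) le_rfl zero_le_one le_rfl zero_le_one ?_
  have hs := (eventually_all_finite (l := 𝓝[>] (0 : ℝ)) hZ (p := fun z ε =>
    ¬ (a < z.1 ∧ z.1 < a + s + ε ∧ b < z.2 ∧ z.2 < b + s + ε))).2 ?_
  · filter_upwards [hs, eventually_add_mul_lt 1 (lt_of_le_of_ne f3 c1),
      eventually_add_mul_lt 1 (lt_of_le_of_ne f4 c2)] with ε e1 e2 e3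
    refine ⟨by linarith, by linarith, by linarith, by linarith, fun z hz hh => e1 z hz ?_⟩
    exact ⟨by linarith [hh.1], by linarith [hh.2.1], by linarith [hh.2.2.1], by linarith [hh.2.2.2]⟩
  · intro z hz
    by_cases d1 : a < z.1 <;> by_cases d2 : z.1 ≤ a + s <;> by_cases d3 : b < z.2
    · filter_upwards [eventually_add_mul_lt 1 (c3 z hz d1 d2 d3)] with ε e hh; linarith
    · exact Eventually.of_forall fun ε hh => d3 hh.2.2.1
    · filter_upwards [eventually_add_mul_lt 1 (not_le.1 d2)] with ε e hh; linarith
    all_goals first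
      | exact Eventually.of_forall fun ε hh => d3 hh.2.2.1
      | exact Eventually.of_forall fun ε hh => d1 hh.1

lemma IsLargestAt.blocked_SE (h : IsLargestAt Z L u v a b s) (hZ : Z.Finite) :
    a + s = L ∨ b = 0 ∨ ∃ z ∈ Z, a < z.1 ∧ z.1 ≤ a + s ∧ b ≤ z.2 ∧ z.2 < b + s := by
  by_contra! hc
  obtain ⟨c1, c2, c3⟩ := hc
  obtain ⟨f1, f2, f3, f4, f5⟩ := h.1
  refine h.not_grow (k := 0) (l := 1) le_rfl zero_le_one zero_le_one le_rfl ?_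
  have hs := (eventually_all_finite (l := 𝓝[>] (0 : ℝ)) hZ (p := fun z ε =>
    ¬ (a < z.1 ∧ z.1 < a + s + ε ∧ b - ε < z.2 ∧ z.2 < b + s))).2 ?_
  · filter_upwards [hs, eventually_add_mul_lt 1 (lt_of_le_of_ne f3 c1),
      eventually_add_mul_lt 1 (lt_of_le_of_ne f2 (Ne.symm c2))] with ε e1 e2 e3
    refine ⟨by linarith, by linarith, by linarith, by linarith, fun z hz hh => e1 z hz ?_⟩
    exact ⟨by linarith [hh.1], by linarith [hh.2.1], by linarith [hh.2.2.1], by linarith [hh.2.2.2]⟩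
  · intro z hz
    by_cases d1 : a < z.1
    · by_cases d2 : z.1 ≤ a + s
      · by_cases d3 : b ≤ z.2
        · exact Eventually.of_forall fun ε hh => absurd (c3 z hz d1 d2 d3) (not_le.2 hh.2.2.2)
        · filter_upwards [eventually_add_mul_lt 1 (not_le.1 d3)] with ε e hh; linarith
      · filter_upwards [eventually_add_mul_lt 1 (not_le.1 d2)] with ε e hh; linarith
    · exact Eventually.of_forall fun ε hh => d1 hh.1

lemma IsLargestAt.blocked_NW (h : IsLargestAt Z L u v a b s) (hZ : Z.Finite) :
    b + s = L ∨ a = 0 ∨ ∃ z ∈ Z, a ≤ z.1 ∧ z.1 < a + s ∧ b < z.2 ∧ z.2 ≤ b + s := by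
  have hZ' : (Prod.swap ⁻¹' Z).Finite := hZ.preimage Prod.swap_injective.injOn
  rcases h.swap.blocked_SE hZ' with h | h | ⟨z, hz, h1, h2, h3, h4⟩
  · exact Or.inl h
  · exact Or.inr (Or.inl h)
  · exact Or.inr (Or.inr ⟨z.swap, hz, h3, h4, h1, h2⟩)

lemma IsLargestAt.blocked_SW (h : IsLargestAt Z L u v a b s) (hZ : Z.Finite) :
    a = 0 ∨ b = 0 ∨ ∃ z ∈ Z, a ≤ z.1 ∧ z.1 < a + s ∧ b ≤ z.2 ∧ z.2 < b + s := by
  by_contra! hc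
  obtain ⟨c1, c2, c3⟩ := hc
  obtain ⟨f1, f2, f3, f4, f5⟩ := h.1
  refine h.not_grow (k := 1) (l := 1) zero_le_one le_rfl zero_le_one le_rfl ?_
  have hs := (eventually_all_finite (l := 𝓝[>] (0 : ℝ)) hZ (p := fun z ε =>
    ¬ (a - ε < z.1 ∧ z.1 < a + s ∧ b - ε < z.2 ∧ z.2 < b + s))).2 ?_
  · filter_upwards [hs, eventually_add_mul_lt 1 (lt_of_le_of_ne f1 (Ne.symm c1)),
      eventually_add_mul_lt 1 (lt_of_le_of_ne f2 (Ne.symm c2))] with ε e1 e2 e3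
    refine ⟨by linarith, by linarith, by linarith, by linarith, fun z hz hh => e1 z hz ?_⟩
    exact ⟨by linarith [hh.1], by linarith [hh.2.1], by linarith [hh.2.2.1], by linarith [hh.2.2.2]⟩
  · intro z hz
    by_cases d1 : a ≤ z.1
    · by_cases d2 : z.1 < a + s
      · by_cases d3 : b ≤ z.2
        · exact Eventually.of_forall fun ε hh => absurd (c3 z hz d1 d2 d3) (not_le.2 hh.2.2.2)
        · filter_upwards [eventually_add_mul_lt 1 (not_le.1 d3)] with ε e hh; linarith
      · exact Eventually.of_forall fun ε hh => d2 hh.2.1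
    · filter_upwards [eventually_add_mul_lt 1 (not_le.1 d1)] with ε e hh; linarith

lemma TouchL.mem_xs (h : TouchL Z a b s) : a ∈ insert 0 (insert L (Prod.fst '' Z)) := by
  rcases h with h | ⟨z, hz, h, -⟩
  · exact Or.inl h
  · exact Or.inr (Or.inr ⟨z, hz, h⟩)

lemma TouchR.mem_xs (h : TouchR Z L a b s) : a + s ∈ insert 0 (insert L (Prod.fst '' Z)) := by
  rcases h with h | ⟨z, hz, h, -⟩
  · exact Or.inr (Or.inl h)
  · exact Or.inr (Or.inr ⟨z, hz, h⟩)

lemma TouchB.mem_ys (h : TouchB Z a b s) : b ∈ insert 0 (insert L (Prod.snd '' Z)) := by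
  rcases h with h | ⟨z, hz, h, -⟩
  · exact Or.inl h
  · exact Or.inr (Or.inr ⟨z, hz, h⟩)

lemma TouchT.mem_ys (h : TouchT Z L a b s) : b + s ∈ insert 0 (insert L (Prod.snd '' Z)) := by
  rcases h with h | ⟨z, hz, h, -⟩
  · exact Or.inr (Or.inl h)
  · exact Or.inr (Or.inr ⟨z, hz, h⟩)

/-- In general position, a square cannot be pinned in both directions. -/
lemma IsGeneric.not_pinned (hG : IsGeneric Z L) (hs : 0 < s) (hsL : s < L)
    (h1 : a ∈ insert 0 (insert L (Prod.fst '' Z)))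
    (h2 : a + s ∈ insert 0 (insert L (Prod.fst '' Z)))
    (h3 : b ∈ insert 0 (insert L (Prod.snd '' Z)))
    (h4 : b + s ∈ insert 0 (insert L (Prod.snd '' Z))) : False := by
  have := hG.diff _ h2 _ h1 _ h4 _ h3 (by ring) (by linarith)
  linarith

/-- A largest free square at a point is blocked on two opposite sides. -/
lemma IsLargestAt.touch_opposite (h : IsLargestAt Z L u v a b s) (hZ : Z.Finite)
    (hG : IsGeneric Z L) (hs : 0 < s) (hsL : s < L) :
    (TouchL Z a b s ∧ TouchR Z L a b s) ∨ (TouchB Z a b s ∧ TouchT Z L a b s) := by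
  -- If a side is untouched, a site blocking growth across it sits in a corner.
  have hNE : TouchR Z L a b s ∨ TouchT Z L a b s ∨ ∃ z ∈ Z, z.1 = a + s ∧ z.2 = b + s := by
    rcases h.blocked_NE hZ with h | h | ⟨z, hz, h1, h2, h3, h4⟩
    · exact Or.inl (Or.inl h)
    · exact Or.inr (Or.inl (Or.inl h))
    · rcases h2.eq_or_lt with e2 | e2
      · rcases h4.eq_or_lt with e4 | e4
        · exact Or.inr (Or.inr ⟨z, hz, e2, e4⟩)
        · exact Or.inl (Or.inr ⟨z, hz, e2, h3, e4⟩)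
      · rcases h4.eq_or_lt with e4 | e4
        · exact Or.inr (Or.inl (Or.inr ⟨z, hz, e4, h1, e2⟩))
        · exact absurd ⟨h1, e2, h3, e4⟩ (h.1.2.2.2.2 z hz)
  have hSE : TouchR Z L a b s ∨ TouchB Z a b s ∨ ∃ z ∈ Z, z.1 = a + s ∧ z.2 = b := by
    rcases h.blocked_SE hZ with h | h | ⟨z, hz, h1, h2, h3, h4⟩
    · exact Or.inl (Or.inl h)
    · exact Or.inr (Or.inl (Or.inl h))
    · rcases h2.eq_or_lt with e2 | e2
      · rcases h3.eq_or_lt with e4 | e4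
        · exact Or.inr (Or.inr ⟨z, hz, e2, e4.symm⟩)
        · exact Or.inl (Or.inr ⟨z, hz, e2, e4, h4⟩)
      · rcases h3.eq_or_lt with e4 | e4
        · exact Or.inr (Or.inl (Or.inr ⟨z, hz, e4.symm, h1, e2⟩))
        · exact absurd ⟨h1, e2, e4, h4⟩ (h.1.2.2.2.2 z hz)
  have hNW : TouchL Z a b s ∨ TouchT Z L a b s ∨ ∃ z ∈ Z, z.1 = a ∧ z.2 = b + s := by
    rcases h.blocked_NW hZ with h | h | ⟨z, hz, h1, h2, h3, h4⟩
    · exact Or.inr (Or.inl (Or.inl h))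
    · exact Or.inl (Or.inl h)
    · rcases h1.eq_or_lt with e2 | e2
      · rcases h4.eq_or_lt with e4 | e4
        · exact Or.inr (Or.inr ⟨z, hz, e2.symm, e4⟩)
        · exact Or.inl (Or.inr ⟨z, hz, e2.symm, h3, e4⟩)
      · rcases h4.eq_or_lt with e4 | e4
        · exact Or.inr (Or.inl (Or.inr ⟨z, hz, e4, e2, h2⟩))
        · exact absurd ⟨e2, h2, h3, e4⟩ (h.1.2.2.2.2 z hz)
  have hSW : TouchL Z a b s ∨ TouchB Z a b s ∨ ∃ z ∈ Z, z.1 = a ∧ z.2 = b := by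
    rcases h.blocked_SW hZ with h | h | ⟨z, hz, h1, h2, h3, h4⟩
    · exact Or.inl (Or.inl h)
    · exact Or.inr (Or.inl (Or.inl h))
    · rcases h1.eq_or_lt with e2 | e2
      · rcases h3.eq_or_lt with e4 | e4
        · exact Or.inr (Or.inr ⟨z, hz, e2.symm, e4.symm⟩)
        · exact Or.inl (Or.inr ⟨z, hz, e2.symm, e4, h4⟩)
      · rcases h3.eq_or_lt with e4 | e4
        · exact Or.inr (Or.inl (Or.inr ⟨z, hz, e4.symm, e2, h2⟩))
        · exact absurd ⟨e2, h2, e4, h4⟩ (h.1.2.2.2.2 z hz)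
  have xs : ∀ {x}, (∃ z ∈ Z, z.1 = x) → x ∈ insert 0 (insert L (Prod.fst '' Z)) :=
    fun h => Or.inr (Or.inr h)
  have ys : ∀ {x}, (∃ z ∈ Z, z.2 = x) → x ∈ insert 0 (insert L (Prod.snd '' Z)) :=
    fun h => Or.inr (Or.inr h)
  by_contra hc
  have pin := @IsGeneric.not_pinned Z L a b s hG hs hsL
  -- A corner site pins the square, together with the two sides that do not contain it.
  rcases hNE with hR | hT | ⟨z, hz, z1, z2⟩
  · have hnL : ¬ TouchL Z a b s := fun hL => hc (Or.inl ⟨hL, hR⟩)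
    rcases hNW with hL | hT | ⟨w, hw, w1, w2⟩
    · exact hnL hL
    · have hnB : ¬ TouchB Z a b s := fun hB => hc (Or.inr ⟨hB, hT⟩)
      rcases hSW with hL | hB | ⟨w, hw, w1, w2⟩
      · exact hnL hL
      · exact hnB hB
      · exact pin (xs ⟨w, hw, w1⟩) hR.mem_xs (ys ⟨w, hw, w2⟩) hT.mem_ys
    · rcases hSW with hL | hB | ⟨w', hw', w1', w2'⟩
      · exact hnL hL
      · exact pin (xs ⟨w, hw, w1⟩) hR.mem_xs hB.mem_ys (ys ⟨w, hw, w2⟩)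
      · exact pin (xs ⟨w, hw, w1⟩) hR.mem_xs (ys ⟨w', hw', w2'⟩) (ys ⟨w, hw, w2⟩)
  · have hnB : ¬ TouchB Z a b s := fun hB => hc (Or.inr ⟨hB, hT⟩)
    rcases hSE with hR | hB | ⟨w, hw, w1, w2⟩
    · have hnL : ¬ TouchL Z a b s := fun hL => hc (Or.inl ⟨hL, hR⟩)
      rcases hSW with hL | hB | ⟨w, hw, w1, w2⟩
      · exact hnL hL
      · exact hnB hB
      · exact pin (xs ⟨w, hw, w1⟩) hR.mem_xs (ys ⟨w, hw, w2⟩) hT.mem_ys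
    · exact hnB hB
    · rcases hSW with hL | hB | ⟨w', hw', w1', w2'⟩
      · exact pin hL.mem_xs (xs ⟨w, hw, w1⟩) (ys ⟨w, hw, w2⟩) hT.mem_ys
      · exact hnB hB
      · exact pin (xs ⟨w', hw', w1'⟩) (xs ⟨w, hw, w1⟩) (ys ⟨w, hw, w2⟩) hT.mem_ys
  · have hx := xs ⟨z, hz, z1⟩
    have hy := ys ⟨z, hz, z2⟩
    have h3 : b ∈ insert 0 (insert L (Prod.snd '' Z)) ∨ TouchR Z L a b s := by
      rcases hSE with h | h | ⟨w, hw, -, w2⟩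
      · exact Or.inr h
      · exact Or.inl h.mem_ys
      · exact Or.inl (ys ⟨w, hw, w2⟩)
    have h4 : a ∈ insert 0 (insert L (Prod.fst '' Z)) ∨ TouchT Z L a b s := by
      rcases hNW with h | h | ⟨w, hw, w1, -⟩
      · exact Or.inl h.mem_xs
      · exact Or.inr h
      · exact Or.inl (xs ⟨w, hw, w1⟩)
    rcases h3 with h3 | hR
    · rcases h4 with h4 | hT
      · exact pin h4 hx h3 hy
      · rcases hSW with h | h | ⟨w, hw, w1, -⟩
        · exact pin h.mem_xs hx h3 hy
        · exact hc (Or.inr ⟨h, hT⟩)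
        · exact pin (xs ⟨w, hw, w1⟩) hx h3 hy
    · rcases h4 with h4 | hT
      · rcases hSW with h | h | ⟨w, hw, -, w2⟩
        · exact hc (Or.inl ⟨h, hR⟩)
        · exact pin h4 hx h.mem_ys hy
        · exact pin h4 hx (ys ⟨w, hw, w2⟩) hy
      · rcases hSW with h | h | ⟨w, hw, w1, w2⟩
        · exact hc (Or.inl ⟨h, hR⟩)
        · exact hc (Or.inr ⟨h, hT⟩)
        · exact pin (xs ⟨w, hw, w1⟩) hx (ys ⟨w, hw, w2⟩) hy

lemma isClosed_setOf_isFree (Z : Set (ℝ × ℝ)) (L : ℝ) :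
    IsClosed {q : ℝ × ℝ × ℝ | IsFree Z L q.1 q.2.1 q.2.2} := by
  have : {q : ℝ × ℝ × ℝ | IsFree Z L q.1 q.2.1 q.2.2} =
      {q | 0 ≤ q.1} ∩ {q | 0 ≤ q.2.1} ∩ {q | q.1 + q.2.2 ≤ L} ∩ {q | q.2.1 + q.2.2 ≤ L} ∩
        ⋂ z ∈ Z, ({q : ℝ × ℝ × ℝ | q.1 < z.1} ∩ {q | z.1 < q.1 + q.2.2} ∩ {q | q.2.1 < z.2} ∩
          {q | z.2 < q.2.1 + q.2.2})ᶜ := by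
    ext q
    simp only [IsFree, Set.mem_ofPred_eq, Set.mem_inter_iff, Set.mem_iInter, Set.mem_compl_iff,
      and_assoc]
  rw [this]
  refine ((((isClosed_le (by fun_prop) (by fun_prop)).inter
    (isClosed_le (by fun_prop) (by fun_prop))).inter
    (isClosed_le (by fun_prop) (by fun_prop))).inter
    (isClosed_le (by fun_prop) (by fun_prop))).inter (isClosed_biInter fun z _ => ?_)
  exact ((((isOpen_lt (by fun_prop) (by fun_prop)).inter
    (isOpen_lt (by fun_prop) (by fun_prop))).inter
    (isOpen_lt (by fun_prop) (by fun_prop))).inter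
    (isOpen_lt (by fun_prop) (by fun_prop))).isClosed_compl

/-- Every point of the big square other than a site lies in a largest free square, by
compactness. -/
lemma exists_isLargestAt (hZ : Z.Finite) (hu : u ∈ Set.Ioo 0 L) (hv : v ∈ Set.Ioo 0 L)
    (hp : (u, v) ∉ Z) : ∃ a b s, 0 < s ∧ IsLargestAt Z L u v a b s := by
  obtain ⟨ε, hε, hball⟩ : ∃ ε > 0, ∀ z ∈ Z, ¬ (u - ε < z.1 ∧ z.1 < u + ε ∧
      v - ε < z.2 ∧ z.2 < v + ε) := by
    obtain ⟨ε, hε, h⟩ := Metric.isOpen_iff.1 hZ.isClosed.isOpen_compl (u, v) hp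
    refine ⟨ε, hε, fun z hz hh => h (show z ∈ Metric.ball (u, v) ε from ?_) hz⟩
    rw [Metric.mem_ball, Prod.dist_eq, max_lt_iff, Real.dist_eq, Real.dist_eq, abs_lt, abs_lt]
    refine ⟨⟨?_, ?_⟩, ?_, ?_⟩ <;> dsimp only <;> linarith [hh.1, hh.2.1, hh.2.2.1, hh.2.2.2]
  obtain ⟨δ, hδ, h1, h2, h3, h4, h5⟩ : ∃ δ > 0, δ ≤ ε ∧ δ ≤ u ∧ δ ≤ v ∧ δ ≤ L - u ∧ δ ≤ L - v := by
    refine ⟨min ε (min (min u v) (min (L - u) (L - v))), ?_, ?_⟩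
    · simp only [gt_iff_lt, lt_min_iff, sub_pos]
      exact ⟨hε, ⟨hu.1, hv.1⟩, hu.2, hv.2⟩
    · simp
  let K : Set (ℝ × ℝ × ℝ) := {q | IsFree Z L q.1 q.2.1 q.2.2} ∩
    ({q | q.1 ≤ u} ∩ {q | u ≤ q.1 + q.2.2} ∩ {q | q.2.1 ≤ v} ∩ {q | v ≤ q.2.1 + q.2.2})
  have hK : IsCompact K := by
    refine (isCompact_Icc (a := ((0, 0, 0) : ℝ × ℝ × ℝ)) (b := (L, L, L))).of_isClosed_subset ?_ ?_
    · exact (isClosed_setOf_isFree Z L).inter ((((isClosed_le (by fun_prop) (by fun_prop)).inter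
        (isClosed_le (by fun_prop) (by fun_prop))).inter
        (isClosed_le (by fun_prop) (by fun_prop))).inter
        (isClosed_le (by fun_prop) (by fun_prop)))
    · rintro ⟨a, b, s⟩ ⟨⟨f1, f2, f3, f4, -⟩, ⟨⟨g1, g2⟩, g3⟩, g4⟩
      simp only [Set.mem_ofPred_eq] at f1 f2 f3 f4 g1 g2 g3 g4
      exact ⟨⟨f1, f2, by dsimp only; linarith⟩, ⟨by dsimp only; linarith [hu.2],
        by dsimp only; linarith [hv.2], by dsimp only; linarith⟩⟩
  have hne : (u - δ, v - δ, 2 * δ) ∈ K := by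
    refine ⟨⟨by dsimp only; linarith, by dsimp only; linarith, by dsimp only; linarith,
      by dsimp only; linarith, fun z hz hh => hball z hz ?_⟩, ⟨⟨?_, ?_⟩, ?_⟩, ?_⟩
    · dsimp only at hh
      exact ⟨by linarith [hh.1], by linarith [hh.2.1], by linarith [hh.2.2.1],
        by linarith [hh.2.2.2]⟩
    all_goals simp only [Set.mem_ofPred_eq]; linarith
  obtain ⟨⟨a, b, s⟩, ⟨hf, ⟨⟨g1, g2⟩, g3⟩, g4⟩, hmax⟩ :=
    hK.exists_isMaxOn ⟨_, hne⟩ (f := fun q => q.2.2) (by fun_prop)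
  refine ⟨a, b, s, ?_, hf, ⟨g1, g2, g3, g4⟩, fun a' b' s' hf' hm => ?_⟩
  · have : 2 * δ ≤ s := hmax hne
    linarith
  · exact hmax (a := (a', b', s')) ⟨hf', ⟨⟨hm.1, hm.2.1⟩, hm.2.2.1⟩, hm.2.2.2⟩

/-- A largest free square that is blocked from below and from above may be slid horizontally until
a third side is blocked. Otherwise both extreme positions would be those with the point `(u, v)` on
a vertical side. They are blocked from below, or from above, by one and the same site, but its first
coordinate would be less than `u` in one of them and greater than `u` in the other. -/
lemma IsLargestAt.slide (h : IsLargestAt Z L u v a b s) (hZ : Z.Finite) (hG : IsGeneric Z L)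
    (hs : 0 < s) (hsL : s < L) (hB : TouchB Z a b s) (hT : TouchT Z L a b s) :
    ∃ a', IsLargestAt Z L u v a' b s ∧ TouchB Z a' b s ∧ TouchT Z L a' b s ∧
      (TouchL Z a' b s ∨ TouchR Z L a' b s) := by
  obtain ⟨hf, ⟨m1, m2, m3, m4⟩, hmax⟩ := h
  let A : Set ℝ := {x | IsFree Z L x b s} ∩ Set.Icc (u - s) u
  have hA : IsCompact A := by
    refine isCompact_Icc.inter_left ?_
    exact (isClosed_setOf_isFree Z L).preimage (f := fun x : ℝ => (x, b, s)) (by fun_prop)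
  have hAne : A.Nonempty := ⟨a, hf, by linarith, m1⟩
  have large : ∀ x ∈ A, IsLargestAt Z L u v x b s := fun x hx =>
    ⟨hx.1, ⟨hx.2.2, by linarith [hx.2.1], m3, m4⟩, hmax⟩
  -- All these squares are largest at `(u, v)`; being pinned vertically, they are not pinned
  -- horizontally, so they are blocked from below and from above.
  have touch : ∀ x ∈ A, TouchB Z x b s ∧ TouchT Z L x b s := by
    intro x hx
    rcases (large x hx).touch_opposite hZ hG hs hsL with ⟨hl, hr⟩ | h
    · exact (hG.not_pinned hs hsL hl.mem_xs hr.mem_xs hB.mem_ys hT.mem_ys).elim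
    · exact h
  obtain ⟨x, hx, hxmin⟩ := hA.exists_isLeast hAne
  obtain ⟨y, hy, hymax⟩ := hA.exists_isGreatest hAne
  by_cases hL : TouchL Z x b s
  · exact ⟨x, large x hx, (touch x hx).1, (touch x hx).2, Or.inl hL⟩
  by_cases hR : TouchR Z L y b s
  · exact ⟨y, large y hy, (touch y hy).1, (touch y hy).2, Or.inr hR⟩
  exfalso
  have hxu : x = u - s := by
    by_contra hne
    have hlt : u - s < x := lt_of_le_of_ne hx.2.1 (Ne.symm hne)
    obtain ⟨f1, f2, f3, f4, f5⟩ := hx.1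
    have hx0 : 0 < x := lt_of_le_of_ne f1 fun e => hL (Or.inl e.symm)
    have hs := (eventually_all_finite (l := 𝓝[>] (0 : ℝ)) hZ (p := fun z ε =>
      ¬ (x - ε < z.1 ∧ z.1 < x + s ∧ b < z.2 ∧ z.2 < b + s))).2 ?_
    · obtain ⟨ε, ⟨⟨e1, e2⟩, e3⟩, hε⟩ := (((hs.and (eventually_add_mul_lt 1 hlt)).and
        (eventually_add_mul_lt 1 hx0)).and self_mem_nhdsWithin).exists
      have hε : 0 < ε := hε
      have : x - ε ∈ A := by
        refine ⟨⟨by linarith, f2, by linarith, f4, fun z hz hh => e1 z hz ?_⟩, by linarith,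
          by linarith [hx.2.2]⟩
        exact ⟨hh.1, by linarith [hh.2.1], hh.2.2⟩
      linarith [hxmin this]
    · intro z hz
      rcases lt_trichotomy z.1 x with h | h | h
      · filter_upwards [eventually_add_mul_lt 1 h] with ε e hh; linarith
      · exact Eventually.of_forall fun ε hh => hL (Or.inr ⟨z, hz, h, hh.2.2⟩)
      · exact Eventually.of_forall fun ε hh => f5 z hz ⟨h, hh.2⟩
  have hyu : y = u := by
    by_contra hne
    have hlt : y < u := lt_of_le_of_ne hy.2.2 hne
    obtain ⟨f1, f2, f3, f4, f5⟩ := hy.1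
    have hy0 : y + s < L := lt_of_le_of_ne f3 fun e => hR (Or.inl e)
    have hs := (eventually_all_finite (l := 𝓝[>] (0 : ℝ)) hZ (p := fun z ε =>
      ¬ (y < z.1 ∧ z.1 < y + s + ε ∧ b < z.2 ∧ z.2 < b + s))).2 ?_
    · obtain ⟨ε, ⟨⟨e1, e2⟩, e3⟩, hε⟩ := (((hs.and (eventually_add_mul_lt 1 hlt)).and
        (eventually_add_mul_lt 1 hy0)).and self_mem_nhdsWithin).exists
      have hε : 0 < ε := hε
      have : y + ε ∈ A := by
        refine ⟨⟨by linarith, f2, by linarith, f4, fun z hz hh => e1 z hz ?_⟩,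
          by linarith [hy.2.1], by linarith⟩
        exact ⟨by linarith [hh.1], by linarith [hh.2.1], hh.2.2⟩
      linarith [hymax this]
    · intro z hz
      rcases lt_trichotomy z.1 (y + s) with h | h | h
      · exact Eventually.of_forall fun ε hh => f5 z hz ⟨hh.1, h, hh.2.2⟩
      · exact Eventually.of_forall fun ε hh => hR (Or.inr ⟨z, hz, h, hh.2.2⟩)
      · filter_upwards [eventually_add_mul_lt 1 h] with ε e hh; linarith
  rcases (touch x hx).1 with h1 | ⟨z, hz, z1, z2, z3⟩
  · rcases (touch x hx).2 with h2 | ⟨z, hz, z1, z2, z3⟩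
    · linarith
    · rcases (touch y hy).2 with h3 | ⟨w, hw, w1, w2, w3⟩
      · linarith
      · rw [hG.snd_inj z hz w hw (z1.trans w1.symm)] at z3
        linarith
  · rcases (touch y hy).1 with h3 | ⟨w, hw, w1, w2, w3⟩
    · rcases (touch x hx).2 with h2 | ⟨z, hz, z1, z2, z3⟩
      · linarith
      · rcases (touch y hy).2 with h3 | ⟨w, hw, w1, w2, w3⟩
        · linarith
        · rw [hG.snd_inj z hz w hw (z1.trans w1.symm)] at z3
          linarith
    · rw [hG.snd_inj z hz w hw (z1.trans w1.symm)] at z3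
      linarith

/-- A free square that is blocked on at least three sides. -/
def IsTight (Z : Set (ℝ × ℝ)) (L a b s : ℝ) : Prop :=
  0 < s ∧ s < L ∧ IsFree Z L a b s ∧
    ((TouchB Z a b s ∧ TouchT Z L a b s ∧ (TouchL Z a b s ∨ TouchR Z L a b s)) ∨
      (TouchL Z a b s ∧ TouchR Z L a b s ∧ (TouchB Z a b s ∨ TouchT Z L a b s)))

/-- The tight squares cover the big square, except for the sites. -/
lemma exists_isTight (hZ : Z.Finite) (hG : IsGeneric Z L)
    (hne : ∃ z ∈ Z, z.1 ∈ Set.Ioo 0 L ∧ z.2 ∈ Set.Ioo 0 L)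
    (hu : u ∈ Set.Ioo 0 L) (hv : v ∈ Set.Ioo 0 L) (hp : (u, v) ∉ Z) :
    ∃ a b s, IsTight Z L a b s ∧ a ≤ u ∧ u ≤ a + s ∧ b ≤ v ∧ v ≤ b + s := by
  obtain ⟨a, b, s, hs, h⟩ := exists_isLargestAt hZ hu hv hp
  have hsL : s < L := by
    obtain ⟨z, hz, ⟨z1, z2⟩, z3, z4⟩ := hne
    obtain ⟨f1, f2, f3, f4, f5⟩ := h.1
    by_contra hc
    exact f5 z hz ⟨by linarith, by linarith, by linarith, by linarith⟩
  rcases h.touch_opposite hZ hG hs hsL with ⟨h1, h2⟩ | ⟨h1, h2⟩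
  · have hsw := h.swap
    obtain ⟨b', hb, t1, t2, t3⟩ := hsw.slide (hZ.preimage Prod.swap_injective.injOn) hG.swap hs hsL
      (by rcases h1 with h1 | ⟨z, hz, h1⟩; exacts [Or.inl h1, Or.inr ⟨z.swap, by simpa using hz, h1⟩])
      (by rcases h2 with h2 | ⟨z, hz, h2⟩; exacts [Or.inl h2, Or.inr ⟨z.swap, by simpa using hz, h2⟩])
    have hb2 := hb.swap
    rw [← Set.preimage_comp, Prod.swap_swap_eq, Set.preimage_id] at hb2
    exact ⟨a, b', s, ⟨hs, hsL, hb2.1, Or.inr ⟨touchB_swap t1, touchT_swap t2,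
      t3.imp touchL_swap touchR_swap⟩⟩, hb2.2.1⟩
  · obtain ⟨a', ha, t⟩ := h.slide hZ hG hs hsL h1 h2
    exact ⟨a', b, s, ⟨hs, hsL, ha.1, Or.inl t⟩, ha.2.1⟩

/-- The square stands on the site `z` and its growth is stopped on either side of `z`. -/
def StandsOn (Z : Set (ℝ × ℝ)) (L : ℝ) (z : ℝ × ℝ) (a b s : ℝ) : Prop :=
  z.2 = b ∧ a < z.1 ∧ z.1 < a + s ∧ b + s < L ∧
    (a = 0 ∨ ∃ w ∈ Z, a ≤ w.1 ∧ w.1 < z.1 ∧ b < w.2 ∧ w.2 ≤ b + s) ∧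
    (a + s = L ∨ ∃ w ∈ Z, z.1 < w.1 ∧ w.1 ≤ a + s ∧ b < w.2 ∧ w.2 ≤ b + s)

/-- The square hangs from the top wall; either `z` is on its left side and the right or the bottom
side is blocked, or `z` is on its bottom side and the right side is blocked. -/
def HangsAt (Z : Set (ℝ × ℝ)) (L : ℝ) (z : ℝ × ℝ) (a b s : ℝ) : Prop :=
  b + s = L ∧
    ((z.1 = a ∧ b < z.2 ∧ z.2 < b + s ∧
        (TouchR Z L a b s ∨ ∃ w ∈ Z, w.2 = b ∧ a < w.1 ∧ w.1 < a + s)) ∨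
      (z.2 = b ∧ a < z.1 ∧ z.1 < a + s ∧ TouchR Z L a b s))

/-- The free square is one of those attributed to the site `z` from above. -/
def IsUp (Z : Set (ℝ × ℝ)) (L : ℝ) (z : ℝ × ℝ) (a b s : ℝ) : Prop :=
  IsFree Z L a b s ∧ (StandsOn Z L z a b s ∨ HangsAt Z L z a b s)

/-- The free square lies in the top left corner, and a site blocks its right or bottom side. -/
def IsTopLeft (Z : Set (ℝ × ℝ)) (L a b s : ℝ) : Prop :=
  IsFree Z L a b s ∧ b + s = L ∧ a = 0 ∧
    ∃ w ∈ Z, (w.1 = a + s ∧ b < w.2 ∧ w.2 < b + s) ∨ (w.2 = b ∧ a < w.1 ∧ w.1 < a + s)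

/-- No two squares are attributed to the same site from above. -/
lemma IsUp.unique (hG : ∀ z ∈ Z, ∀ w ∈ Z, z.2 = w.2 → z = w) {z : ℝ × ℝ} {a' b' s' : ℝ}
    (h : IsUp Z L z a b s) (h' : IsUp Z L z a' b' s') : a = a' ∧ b = b' ∧ s = s' := by
  -- What stops the growth of the smaller square would also bound the larger one.
  have one : ∀ {a b s a' b' s' : ℝ}, IsFree Z L a b s → IsFree Z L a' b' s' →
      StandsOn Z L z a b s → (z.2 = b' ∧ a' < z.1 ∧ z.1 < a' + s') → s < s' → False := by
    rintro a b s a' b' s' ⟨f1, f2, f3, f4, f5⟩ ⟨g1, g2, g3, g4, g5⟩ ⟨h1, h2, h3, h4, hl, hr⟩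
      ⟨k1, k2, k3⟩ hlt
    have e1 : a ≤ a' := by
      rcases hl with hl | ⟨w, hw, w1, w2, w3, w4⟩
      · linarith
      · by_contra! hc
        exact g5 w hw ⟨by linarith, by linarith, by linarith, by linarith⟩
    have e2 : a' + s' ≤ a + s := by
      rcases hr with hr | ⟨w, hw, w1, w2, w3, w4⟩
      · linarith
      · by_contra! hc
        exact g5 w hw ⟨by linarith, by linarith, by linarith, by linarith⟩
    linarith
  -- For equal sizes, the stopping sites on either side of `z` lie on the common top line, so they
  -- coincide.
  have two : ∀ {a b s a' b' : ℝ}, IsFree Z L a b s → IsFree Z L a' b' s →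
      StandsOn Z L z a b s → StandsOn Z L z a' b' s → a < a' → False := by
    rintro a b s a' b' ⟨f1, f2, f3, f4, f5⟩ ⟨g1, g2, g3, g4, g5⟩ ⟨h1, h2, h3, h4, hl, hr⟩
      ⟨k1, k2, k3, k4, kl, kr⟩ hlt
    rcases hr with hr | ⟨w, hw, w1, w2, w3, w4⟩
    · linarith
    rcases kl with kl | ⟨x, hx, x1, x2, x3, x4⟩
    · linarith
    have e1 : b + s ≤ w.2 := by
      by_contra! hc
      exact g5 w hw ⟨by linarith, by linarith, by linarith, by linarith⟩
    have e2 : b + s ≤ x.2 := by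
      by_contra! hc
      exact f5 x hx ⟨by linarith, by linarith, by linarith, by linarith⟩
    have := hG w hw x hx (by linarith)
    rw [this] at w1
    linarith
  -- A square standing on `z` is smaller than one hanging from the top wall, so the same applies.
  have three : ∀ {a b s a' b' s' : ℝ}, IsFree Z L a b s → IsFree Z L a' b' s' →
      StandsOn Z L z a b s → HangsAt Z L z a' b' s' → False := by
    rintro a b s a' b' s' hf hf' hs ⟨h0, ⟨h1, h2, h3, -⟩ | ⟨h1, h2, h3, -⟩⟩
    · obtain ⟨f1, f2, f3, f4, f5⟩ := hf
      obtain ⟨g1, g2, g3, g4, g5⟩ := hf'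
      obtain ⟨k1, k2, k3, k4, kl, kr⟩ := hs
      have e2 : a' + s' ≤ a + s := by
        rcases kr with hr | ⟨w, hw, w1, w2, w3, w4⟩
        · linarith
        · by_contra! hc
          exact g5 w hw ⟨by linarith, by linarith, by linarith, by linarith⟩
      linarith
    · exact one hf hf' hs ⟨h1, h2, h3⟩ (by linarith [hs.1, hs.2.2.2.1])
  -- The site that blocks the smaller of two hanging squares would be inside the larger one.
  have four : ∀ {a b s a' b' s' : ℝ}, IsFree Z L a b s → IsFree Z L a' b' s' →
      HangsAt Z L z a b s → HangsAt Z L z a' b' s' → s < s' → False := by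
    rintro a b s a' b' s' ⟨f1, f2, f3, f4, f5⟩ ⟨g1, g2, g3, g4, g5⟩ ⟨h0, h⟩ ⟨k0, k⟩ hlt
    rcases h with ⟨h1, h2, h3, (h | ⟨w, hw, w1, w2, w3⟩) | ⟨w, hw, w1, w2, w3⟩⟩ |
      ⟨h1, h2, h3, h | ⟨w, hw, w1, w2, w3⟩⟩ <;>
    rcases k with ⟨k1, k2, k3, -⟩ | ⟨k1, k2, k3, -⟩
    all_goals first
      | linarith
      | exact g5 w hw ⟨by linarith, by linarith, by linarith, by linarith⟩
  -- For equal sizes, the site on the right of the square further left would be inside the other.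
  have five : ∀ {a b s a' b' : ℝ}, IsFree Z L a b s → IsFree Z L a' b' s →
      HangsAt Z L z a b s → HangsAt Z L z a' b' s → a < a' → False := by
    rintro a b s a' b' ⟨f1, f2, f3, f4, f5⟩ ⟨g1, g2, g3, g4, g5⟩ ⟨h0, h⟩ ⟨k0, k⟩ hlt
    rcases h with ⟨h1, h2, h3, -⟩ | ⟨h1, h2, h3, h | ⟨w, hw, w1, w2, w3⟩⟩ <;>
    rcases k with ⟨k1, k2, k3, -⟩ | ⟨k1, k2, k3, -⟩
    all_goals first
      | linarith
      | exact g5 w hw ⟨by linarith, by linarith, by linarith, by linarith⟩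
  obtain ⟨hf, h⟩ := h
  obtain ⟨hf', h'⟩ := h'
  rcases h with h | h <;> rcases h' with h' | h'
  · rcases lt_trichotomy s s' with e | e | e
    · exact (one hf hf' h ⟨h'.1, h'.2.1, h'.2.2.1⟩ e).elim
    · subst e
      rcases lt_trichotomy a a' with e | e | e
      · exact (two hf hf' h h' e).elim
      · exact ⟨e, by linarith [h.1, h'.1], rfl⟩
      · exact (two hf' hf h' h e).elim
    · exact (one hf' hf h' ⟨h.1, h.2.1, h.2.2.1⟩ e).elim
  · exact (three hf hf' h h').elim
  · exact (three hf' hf h' h).elim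
  · rcases lt_trichotomy s s' with e | e | e
    · exact (four hf hf' h h' e).elim
    · subst e
      rcases lt_trichotomy a a' with e | e | e
      · exact (five hf hf' h h' e).elim
      · exact ⟨e, by linarith [h.1, h'.1], rfl⟩
      · exact (five hf' hf h' h e).elim
    · exact (four hf' hf h' h e).elim

lemma IsTopLeft.unique {a' b' s' : ℝ} (h : IsTopLeft Z L a b s) (h' : IsTopLeft Z L a' b' s') :
    a = a' ∧ b = b' ∧ s = s' := by
  have one : ∀ {a b s a' b' s' : ℝ}, IsTopLeft Z L a b s → IsTopLeft Z L a' b' s' →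
      s < s' → False := by
    rintro a b s a' b' s' ⟨⟨f1, f2, f3, f4, f5⟩, h1, h2, w, hw, hh⟩ ⟨⟨g1, g2, g3, g4, g5⟩, k1, k2, -⟩
      hlt
    rcases hh with hh | hh <;>
      exact g5 w hw ⟨by linarith, by linarith, by linarith, by linarith⟩
  rcases lt_trichotomy s s' with e | e | e
  · exact (one h h' e).elim
  · exact ⟨by linarith [h.2.2.1, h'.2.2.1], by linarith [h.2.1, h'.2.1], e⟩
  · exact (one h' h e).elim

/-- The reflection of the square `[0, L] × [0, L]` in its horizontal midline. -/
def flip (L : ℝ) (z : ℝ × ℝ) : ℝ × ℝ := (z.1, L - z.2)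

@[simp] lemma flip_flip (z : ℝ × ℝ) : flip L (flip L z) = z := by simp [flip]

lemma preimage_flip_flip : flip L ⁻¹' (flip L ⁻¹' Z) = Z := by
  ext z; simp

lemma exists_flip {p : ℝ × ℝ → Prop} (h : ∃ z ∈ Z, p z) : ∃ z ∈ flip L ⁻¹' Z, p (flip L z) := by
  obtain ⟨z, hz, h⟩ := h
  exact ⟨flip L z, by simpa using hz, by simpa using h⟩

lemma IsFree.flip (h : IsFree Z L a b s) : IsFree (flip L ⁻¹' Z) L a (L - b - s) s := by
  obtain ⟨h1, h2, h3, h4, h5⟩ := h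
  refine ⟨h1, by linarith, h3, by linarith, fun z hz hh => h5 _ hz ?_⟩
  simp only [CakeCutting.flip]
  exact ⟨hh.1, hh.2.1, by linarith [hh.2.2.2], by linarith [hh.2.2.1]⟩

lemma TouchL.flip (h : TouchL Z a b s) : TouchL (flip L ⁻¹' Z) a (L - b - s) s := by
  refine h.imp id fun h => ?_
  obtain ⟨z, hz, h1, h2, h3⟩ := exists_flip (L := L) h
  simp only [CakeCutting.flip] at h1 h2 h3
  exact ⟨z, hz, h1, by linarith, by linarith⟩

lemma TouchR.flip (h : TouchR Z L a b s) : TouchR (flip L ⁻¹' Z) L a (L - b - s) s := by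
  refine h.imp id fun h => ?_
  obtain ⟨z, hz, h1, h2, h3⟩ := exists_flip (L := L) h
  simp only [CakeCutting.flip] at h1 h2 h3
  exact ⟨z, hz, h1, by linarith, by linarith⟩

lemma TouchB.flip (h : TouchB Z a b s) : TouchT (flip L ⁻¹' Z) L a (L - b - s) s := by
  refine h.imp (fun h => by linarith) fun h => ?_
  obtain ⟨z, hz, h1, h2, h3⟩ := exists_flip (L := L) h
  simp only [CakeCutting.flip] at h1 h2 h3
  exact ⟨z, hz, by linarith, by linarith, by linarith⟩

lemma TouchT.flip (h : TouchT Z L a b s) : TouchB (flip L ⁻¹' Z) a (L - b - s) s := by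
  refine h.imp (fun h => by linarith) fun h => ?_
  obtain ⟨z, hz, h1, h2, h3⟩ := exists_flip (L := L) h
  simp only [CakeCutting.flip] at h1 h2 h3
  exact ⟨z, hz, by linarith, by linarith, by linarith⟩

/-- The square is attributed to a site, from above or from below, or to one of the left corners. -/
def IsAttributed (Z : Set (ℝ × ℝ)) (L a b s : ℝ) : Prop :=
  (∃ z ∈ Z, IsUp Z L z a b s ∨ IsUp (flip L ⁻¹' Z) L (flip L z) a (L - b - s) s) ∨
    IsTopLeft Z L a b s ∨ IsTopLeft (flip L ⁻¹' Z) L a (L - b - s) s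

lemma IsAttributed.of_flip (h : IsAttributed (flip L ⁻¹' Z) L a (L - b - s) s) :
    IsAttributed Z L a b s := by
  have e : L - (L - b - s) - s = b := by ring
  rcases h with ⟨z, hz, h⟩ | h
  · rw [preimage_flip_flip, e] at h
    refine Or.inl ⟨flip L z, hz, ?_⟩
    rw [flip_flip]
    exact h.symm
  · rw [preimage_flip_flip, e] at h
    exact Or.inr h.symm

/-- A square blocked on the left, on the right and from below is attributed to its bottom site; if it
stands on the bottom wall, then to its left site, or else to the bottom left corner. -/
lemma isAttributed_of_touchB (hs : s < L) (hf : IsFree Z L a b s) (hL : TouchL Z a b s)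
    (hR : TouchR Z L a b s) (hB : TouchB Z a b s) : IsAttributed Z L a b s := by
  rcases hB with hB | ⟨z, hz, z1, z2, z3⟩
  · rcases hL with hL | ⟨z, hz, z1, z2, z3⟩
    · rcases hR with hR | ⟨z, hz, z1, z2, z3⟩
      · linarith
      · refine Or.inr (Or.inr ⟨hf.flip, by linarith, hL, flip L z, by simpa using hz, Or.inl ?_⟩)
        simp only [flip]
        exact ⟨z1, by linarith, by linarith⟩
    · refine Or.inl ⟨z, hz, Or.inr ⟨hf.flip, Or.inr ⟨by linarith, Or.inl ?_⟩⟩⟩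
      refine ⟨z1, ?_, ?_, Or.inl hR.flip⟩ <;> simp only [flip] <;> linarith
  · refine Or.inl ⟨z, hz, Or.inl ⟨hf, ?_⟩⟩
    rcases hf.2.2.2.1.eq_or_lt with e | e
    · exact Or.inr ⟨e, Or.inr ⟨z1, z2, z3, hR⟩⟩
    · refine Or.inl ⟨z1, z2, z3, e, hL.imp id ?_, hR.imp id ?_⟩
      · rintro ⟨w, hw, w1, w2, w3⟩
        exact ⟨w, hw, by linarith, by linarith, by linarith, by linarith⟩
      · rintro ⟨w, hw, w1, w2, w3⟩
        exact ⟨w, hw, by linarith, by linarith, by linarith, by linarith⟩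

/-- A tight square hanging from the top wall is attributed to the left site, to the top left corner
if the left side is on the wall, or to the bottom site if only the right side is blocked. -/
lemma isAttributed_of_touch_top_wall (hs : s < L) (hf : IsFree Z L a b s) (hT : b + s = L)
    (hB : TouchB Z a b s) (hLR : TouchL Z a b s ∨ TouchR Z L a b s) : IsAttributed Z L a b s := by
  rcases hB with hB | ⟨z, hz, z1, z2, z3⟩
  · linarith
  rcases hLR with (hL | ⟨w, hw, w1, w2, w3⟩) | hR
  · exact Or.inr (Or.inl ⟨hf, hT, hL, z, hz, Or.inr ⟨z1, z2, z3⟩⟩)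
  · exact Or.inl ⟨w, hw, Or.inl ⟨hf, Or.inr ⟨hT, Or.inl ⟨w1, w2, w3, Or.inr ⟨z, hz, z1, z2, z3⟩⟩⟩⟩⟩
  · exact Or.inl ⟨z, hz, Or.inl ⟨hf, Or.inr ⟨hT, Or.inr ⟨z1, z2, z3, hR⟩⟩⟩⟩

/-- A square with a site on its bottom and a site on its top stands on the bottom site, if the growth
is stopped by the top site on one side of it and by a side of the square on the other. -/
lemma isAttributed_of_sites (hf : IsFree Z L a b s) (hT : b + s < L)
    {z w : ℝ × ℝ} (hz : z ∈ Z) (hw : w ∈ Z) (z1 : z.2 = b) (z2 : a < z.1) (z3 : z.1 < a + s)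
    (w1 : w.2 = b + s) (w2 : a < w.1) (w3 : w.1 < a + s)
    (h : (TouchL Z a b s ∧ z.1 < w.1) ∨ (TouchR Z L a b s ∧ w.1 < z.1)) :
    IsAttributed Z L a b s := by
  refine Or.inl ⟨z, hz, Or.inl ⟨hf, Or.inl ⟨z1, z2, z3, hT, ?_⟩⟩⟩
  rcases h with ⟨hL, h⟩ | ⟨hR, h⟩
  · refine ⟨hL.imp id ?_, Or.inr ⟨w, hw, h, by linarith, by linarith, by linarith⟩⟩
    rintro ⟨x, hx, x1, x2, x3⟩
    exact ⟨x, hx, by linarith, by linarith, by linarith, by linarith⟩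
  · refine ⟨Or.inr ⟨w, hw, by linarith, by linarith, by linarith, by linarith⟩, hR.imp id ?_⟩
    rintro ⟨x, hx, x1, x2, x3⟩
    exact ⟨x, hx, by linarith, by linarith, by linarith, by linarith⟩

lemma IsTight.isAttributed (hG : ∀ z ∈ Z, ∀ w ∈ Z, z.1 = w.1 → z = w) (h : IsTight Z L a b s) :
    IsAttributed Z L a b s := by
  obtain ⟨hs, hsL, hf, ⟨hB, hT, hLR⟩ | ⟨hL, hR, hB | hT⟩⟩ := h
  · rcases hf.2.2.2.1.eq_or_lt with e | e
    · exact isAttributed_of_touch_top_wall hsL hf e hB hLR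
    rcases hf.2.1.eq_or_lt with e' | e'
    · exact (isAttributed_of_touch_top_wall hsL hf.flip (by linarith) hT.flip
        (hLR.imp TouchL.flip TouchR.flip)).of_flip
    rcases hB with hB | ⟨z, hz, z1, z2, z3⟩
    · linarith
    rcases hT with hT | ⟨w, hw, w1, w2, w3⟩
    · linarith
    have key : (TouchL Z a b s ∧ z.1 < w.1) ∨ (TouchR Z L a b s ∧ w.1 < z.1) →
        IsAttributed Z L a b s := isAttributed_of_sites hf e hz hw z1 z2 z3 w1 w2 w3
    have key' : (TouchL Z a b s ∧ w.1 < z.1) ∨ (TouchR Z L a b s ∧ z.1 < w.1) →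
        IsAttributed Z L a b s := by
      intro h
      refine IsAttributed.of_flip (isAttributed_of_sites hf.flip (by linarith)
        (z := flip L w) (w := flip L z) (by simpa using hw) (by simpa using hz) ?_ w2 w3 ?_ z2 z3
        (h.imp (And.imp TouchL.flip id) (And.imp TouchR.flip id))) <;>
      simp only [flip] <;> linarith
    rcases lt_trichotomy z.1 w.1 with h | h | h
    · exact hLR.elim (fun h' => key (Or.inl ⟨h', h⟩)) fun h' => key' (Or.inr ⟨h', h⟩)
    · rw [hG z hz w hw h] at z1
      linarith
    · exact hLR.elim (fun h' => key' (Or.inl ⟨h', h⟩)) fun h' => key (Or.inr ⟨h', h⟩)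
  · exact isAttributed_of_touchB hsL hf hL hR hB
  · exact (isAttributed_of_touchB hsL hf.flip hL.flip hR.flip hT.flip).of_flip

/-- An open square from which `M` generic points are removed is covered by `2 * M + 2` free
squares. -/
theorem exists_cover (hL : 0 < L) (hZ : Z.Finite) (hG : IsGeneric Z L)
    (hZL : ∀ z ∈ Z, z.1 ∈ Set.Ioo 0 L ∧ z.2 ∈ Set.Ioo 0 L) :
    ∃ Q : Finset (ℝ × ℝ × ℝ), Q.card ≤ 2 * Z.ncard + 2 ∧
      (∀ q ∈ Q, 0 < q.2.2 ∧ IsFree Z L q.1 q.2.1 q.2.2) ∧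
      ∀ u ∈ Set.Ioo 0 L, ∀ v ∈ Set.Ioo 0 L, (u, v) ∉ Z →
        ∃ q ∈ Q, q.1 ≤ u ∧ u ≤ q.1 + q.2.2 ∧ q.2.1 ≤ v ∧ v ≤ q.2.1 + q.2.2 := by
  classical
  rcases Z.eq_empty_or_nonempty with rfl | ⟨z0, hz0⟩
  · refine ⟨{(0, 0, L)}, by simp, ?_, ?_⟩
    · simp [IsFree, hL]
    · intro u hu v hv _
      exact ⟨_, Finset.mem_singleton_self _, hu.1.le, by simpa using hu.2.le, hv.1.le,
        by simpa using hv.2.le⟩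
  let T : Set (ℝ × ℝ × ℝ) := {q | IsTight Z L q.1 q.2.1 q.2.2}
  let R : ℝ × ℝ × ℝ → (Z × Bool) ⊕ Bool → Prop := fun q c =>
    match c with
    | .inl (z, true) => IsUp Z L z q.1 q.2.1 q.2.2
    | .inl (z, false) => IsUp (flip L ⁻¹' Z) L (flip L z) q.1 (L - q.2.1 - q.2.2) q.2.2
    | .inr true => IsTopLeft Z L q.1 q.2.1 q.2.2
    | .inr false => IsTopLeft (flip L ⁻¹' Z) L q.1 (L - q.2.1 - q.2.2) q.2.2
  have hR : ∀ q ∈ T, ∃ c, R q c := by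
    intro q hq
    rcases IsTight.isAttributed hG.fst_inj hq with ⟨z, hz, h | h⟩ | h | h
    exacts [⟨.inl (⟨z, hz⟩, true), h⟩, ⟨.inl (⟨z, hz⟩, false), h⟩, ⟨.inr true, h⟩, ⟨.inr false, h⟩]
  have hinj : ∀ q q' c, R q c → R q' c → q = q' := by
    have hG' : ∀ z ∈ flip L ⁻¹' Z, ∀ w ∈ flip L ⁻¹' Z, z.2 = w.2 → z = w := by
      intro z hz w hw h
      have := hG.snd_inj _ hz _ hw (by simp [flip, h])
      rw [← flip_flip (L := L) z, this, flip_flip]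
    rintro ⟨a, b, s⟩ ⟨a', b', s'⟩ (⟨z, _ | _⟩ | _ | _) h h'
    · obtain ⟨h1, h2, h3⟩ := IsUp.unique hG' h h'
      dsimp only at h1 h2 h3
      ext <;> dsimp only <;> linarith
    · obtain ⟨h1, h2, h3⟩ := IsUp.unique hG.snd_inj h h'
      dsimp only at h1 h2 h3
      ext <;> dsimp only <;> linarith
    · obtain ⟨h1, h2, h3⟩ := IsTopLeft.unique h h'
      dsimp only at h1 h2 h3
      ext <;> dsimp only <;> linarith
    · obtain ⟨h1, h2, h3⟩ := IsTopLeft.unique h h'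
      dsimp only at h1 h2 h3
      ext <;> dsimp only <;> linarith
  let f : ℝ × ℝ × ℝ → (Z × Bool) ⊕ Bool := fun q => if h : ∃ c, R q c then h.choose else .inr true
  have hf : ∀ q ∈ T, R q (f q) := fun q hq => by
    simp only [f, dif_pos (hR q hq)]
    exact (hR q hq).choose_spec
  have hfi : Set.InjOn f T := fun q hq q' hq' e => hinj q q' (f q) (hf q hq) (e ▸ hf q' hq')
  have : Fintype Z := hZ.fintype
  have hT : T.Finite := Set.Finite.of_injOn (Set.mapsTo_univ f T) hfi Set.finite_univ
  have hcard : hT.toFinset.card ≤ 2 * Z.ncard + 2 := by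
    have := Set.ncard_le_ncard_of_injOn f (fun a _ => Set.mem_univ (f a)) hfi
    rw [Set.ncard_univ, Nat.card_eq_fintype_card, Fintype.card_sum, Fintype.card_prod,
      Fintype.card_bool, ← Nat.card_eq_fintype_card, Nat.card_coe_set_eq] at this
    rw [← Set.ncard_eq_toFinset_card T hT]
    omega
  refine ⟨hT.toFinset, hcard, fun q hq => ?_, fun u hu v hv huv => ?_⟩
  · have hq : IsTight Z L q.1 q.2.1 q.2.2 := hT.mem_toFinset.1 hq
    exact ⟨hq.1, hq.2.2.1⟩
  · obtain ⟨a, b, s, ht, h⟩ := exists_isTight hZ hG ⟨z0, hz0, hZL z0 hz0⟩ hu hv huv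
    exact ⟨(a, b, s), hT.mem_toFinset.2 ht, h⟩

/-! ### General position -/

lemma IsGeneric.mono {W : Set (ℝ × ℝ)} (h : IsGeneric Z L) (hW : W ⊆ Z) : IsGeneric W L := by
  have h1 : ∀ f : ℝ × ℝ → ℝ, insert 0 (insert L (f '' W)) ⊆ insert 0 (insert L (f '' Z)) :=
    fun f => Set.insert_subset_insert (Set.insert_subset_insert (Set.image_mono hW))
  exact ⟨fun z hz w hw => h.fst_inj z (hW hz) w (hW hw),
    fun z hz w hw => h.snd_inj z (hW hz) w (hW hw), fun x hx x' hx' y hy y' hy' =>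
      h.diff x (h1 _ hx) x' (h1 _ hx') y (h1 _ hy) y' (h1 _ hy')⟩

lemma exists_abs_sub_lt_notMem {F : Set ℝ} (hF : F.Finite) (x : ℝ) {ε : ℝ} (hε : 0 < ε) :
    ∃ y, |y - x| < ε ∧ y ∉ F := by
  obtain ⟨y, hy, hyF⟩ := (Set.Ioo_infinite (show x - ε < x + ε by linarith)).exists_notMem_finite hF
  exact ⟨y, abs_lt.2 ⟨by linarith [hy.1], by linarith [hy.2]⟩, hyF⟩

/-- A point can be added to a set in general position, after moving it by less than `ε`: its first
coordinate, and then its second, has to avoid finitely many values. -/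
lemma IsGeneric.exists_insert (hG : IsGeneric Z L) (hZ : Z.Finite) (z : ℝ × ℝ) {ε : ℝ}
    (hε : 0 < ε) : ∃ w : ℝ × ℝ, |w.1 - z.1| < ε ∧ |w.2 - z.2| < ε ∧ IsGeneric (insert w Z) L := by
  set X := insert 0 (insert L (Prod.fst '' Z)) with hX
  set Y := insert 0 (insert L (Prod.snd '' Z)) with hY
  have hXf : X.Finite := ((hZ.image _).insert _).insert _
  have hYf : Y.Finite := ((hZ.image _).insert _).insert _
  obtain ⟨x, hx, hxF⟩ := exists_abs_sub_lt_notMem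
    ((hXf.prod (hYf.prod hYf)).image fun t : ℝ × ℝ × ℝ => t.1 + (t.2.1 - t.2.2)) z.1 hε
  have hXf' := hXf.insert x
  obtain ⟨y, hy, hyF⟩ := exists_abs_sub_lt_notMem
    ((hYf.prod (hXf'.prod hXf')).image fun t : ℝ × ℝ × ℝ => t.1 + (t.2.1 - t.2.2)) z.2 hε
  have ex : ∀ p ∈ X, ∀ q ∈ Y, ∀ r ∈ Y, x ≠ p + (q - r) :=
    fun p hp q hq r hr e => hxF ⟨(p, q, r), ⟨hp, hq, hr⟩, e.symm⟩
  have ey : ∀ p ∈ Y, ∀ q ∈ insert x X, ∀ r ∈ insert x X, y ≠ p + (q - r) :=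
    fun p hp q hq r hr e => hyF ⟨(p, q, r), ⟨hp, hq, hr⟩, e.symm⟩
  have h0Y : (0 : ℝ) ∈ Y := Or.inl rfl
  have hxZ : ∀ w ∈ Z, w.1 ≠ x := fun w hw e =>
    ex w.1 (Or.inr (Or.inr ⟨w, hw, rfl⟩)) 0 h0Y 0 h0Y (by linarith)
  have hyZ : ∀ w ∈ Z, w.2 ≠ y := fun w hw e =>
    ey w.2 (Or.inr (Or.inr ⟨w, hw, rfl⟩)) x (Or.inl rfl) x (Or.inl rfl) (by linarith)
  refine ⟨(x, y), hx, hy, ?_, ?_, ?_⟩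
  · rintro p (rfl | hp) q (rfl | hq) e
    exacts [rfl, (hxZ q hq e.symm).elim, (hxZ p hp e).elim, hG.fst_inj p hp q hq e]
  · rintro p (rfl | hp) q (rfl | hq) e
    exacts [rfl, (hyZ q hq e.symm).elim, (hyZ p hp e).elim, hG.snd_inj p hp q hq e]
  · have i1 : insert 0 (insert L (Prod.fst '' insert (x, y) Z)) = insert x X := by
      rw [Set.image_insert_eq, Set.insert_comm L, Set.insert_comm 0]
    have i2 : insert 0 (insert L (Prod.snd '' insert (x, y) Z)) = insert y Y := by
      rw [Set.image_insert_eq, Set.insert_comm L, Set.insert_comm 0]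
    rw [i1, i2]
    rintro p hp q hq r (rfl | hr) t (rfl | ht) e hpos
    · linarith
    · exact (ey t ht p hp q hq (by linarith)).elim
    · exact (ey r hr q hq p hp (by linarith)).elim
    · rcases hp with rfl | hp <;> rcases hq with rfl | hq
      · linarith
      · exact (ex q hq r hr t ht (by linarith)).elim
      · exact (ex p hp t ht r hr (by linarith)).elim
      · exact hG.diff p hp q hq r hr t ht e hpos

/-- Finitely many points can be moved into general position by an arbitrarily small amount. -/
lemma exists_isGeneric_near (hL : 0 < L) (F : Finset (ℝ × ℝ)) {ε : ℝ} (hε : 0 < ε) :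
    ∃ W : Set (ℝ × ℝ), W.Finite ∧ W.ncard ≤ F.card ∧ IsGeneric W L ∧
      ∀ z ∈ F, ∃ w ∈ W, |w.1 - z.1| < ε ∧ |w.2 - z.2| < ε := by
  classical
  induction F using Finset.induction_on with
  | empty =>
    refine ⟨∅, Set.finite_empty, by simp, ⟨by simp, by simp, ?_⟩, by simp⟩
    simp only [Set.image_empty]
    rintro x (rfl | rfl | hx) x' (rfl | rfl | hx') y - y' - - h
    any_goals exact (Set.notMem_empty _ ‹_›).elim
    all_goals linarith
  | insert z F hz ih =>
    obtain ⟨W, hW, hc, hG, hn⟩ := ih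
    obtain ⟨w, w1, w2, hw⟩ := hG.exists_insert hW z hε
    refine ⟨insert w W, hW.insert w, ?_, hw, ?_⟩
    · rw [Finset.card_insert_of_notMem hz]
      exact (Set.ncard_insert_le w W).trans (by omega)
    · intro x hx
      rcases Finset.mem_insert.1 hx with rfl | hx
      · exact ⟨w, Or.inl rfl, w1, w2⟩
      · obtain ⟨w', h1, h2⟩ := hn x hx
        exact ⟨w', Or.inr h1, h2⟩

end

/-! ### Piercing the squares that meet a square which is not larger -/

/-- The centres of the axis-parallel unit squares meeting a rotated unit square centred at the
origin lie in an octagon, which is covered by eight unit squares. Six of them cover the part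
`x ≤ 2 - H` of the bounding box; the rest of the octagon is a strip of height at most `2`. -/
lemma exists_pierce_octagon {C S H : ℝ} (hC : 0 ≤ C) (hS : 0 ≤ S) (h1 : C ^ 2 + S ^ 2 = 1)
    (hH : H = (1 + C + S) / 2) :
    ∃ z : Fin 8 → ℝ × ℝ, ∀ x y : ℝ, |x| ≤ H → |y| ≤ H → |C * x + S * y| ≤ H →
      |-S * x + C * y| ≤ H → ∃ k, |(z k).1 - x| ≤ 1 / 2 ∧ |(z k).2 - y| ≤ 1 / 2 := by
  have hw : 1 ≤ C + S := by nlinarith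
  have hH2 : H ≤ 3 / 2 := by nlinarith [sq_nonneg (C - S)]
  have hH1 : 1 ≤ H := by linarith
  refine ⟨![(-H + 1 / 2, H - 1 / 2), (-H + 1 / 2, 0), (-H + 1 / 2, -H + 1 / 2),
    (-H + 3 / 2, H - 1 / 2), (-H + 3 / 2, 0), (-H + 3 / 2, -H + 1 / 2),
    (H - 1 / 2, (H - C * (2 - H)) / S - 1 / 2), (H - 1 / 2, (S * (2 - H) - H) / C + 1 / 2)],
    fun x y hx hy hu hv => ?_⟩
  simp only [abs_le] at hx hy hu hv ⊢
  by_cases hxH : x ≤ 2 - H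
  · by_cases c1 : x ≤ -H + 1
    · by_cases c2 : H - 1 ≤ y
      · exact ⟨0, by dsimp; constructor <;> constructor <;> linarith⟩
      · by_cases c3 : -(1 / 2) ≤ y
        · exact ⟨1, by dsimp; constructor <;> constructor <;> linarith⟩
        · exact ⟨2, by dsimp; constructor <;> constructor <;> linarith⟩
    · by_cases c2 : H - 1 ≤ y
      · exact ⟨3, by dsimp; constructor <;> constructor <;> linarith⟩
      · by_cases c3 : -(1 / 2) ≤ y
        · exact ⟨4, by dsimp; constructor <;> constructor <;> linarith⟩
        · exact ⟨5, by dsimp; constructor <;> constructor <;> linarith⟩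
  · push Not at hxH
    have hCpos : 0 < C := by
      refine lt_of_le_of_ne hC fun e => ?_
      subst e
      have : S = 1 := by nlinarith
      linarith
    have hSpos : 0 < S := by
      refine lt_of_le_of_ne hS fun e => ?_
      subst e
      have : C = 1 := by nlinarith
      linarith
    have hhi : y ≤ (H - C * (2 - H)) / S := by
      rw [le_div_iff₀ hSpos]
      nlinarith
    have hlo : (S * (2 - H) - H) / C ≤ y := by
      rw [div_le_iff₀ hCpos]
      nlinarith
    have hgap : (H - C * (2 - H)) / S - (S * (2 - H) - H) / C ≤ 2 := by
      rw [div_sub_div _ _ hSpos.ne' hCpos.ne', div_le_iff₀ (mul_pos hSpos hCpos)]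
      have : (H - C * (2 - H)) * C - S * (S * (2 - H) - H) =
          H * (C + S) - (2 - H) * (C ^ 2 + S ^ 2) := by ring
      rw [this, h1, hH]
      nlinarith [sq_nonneg (C + S - 1)]
    by_cases c : (H - C * (2 - H)) / S - 1 ≤ y
    · exact ⟨6, by
        change (_ ≤ (H - 1 / 2) - x ∧ (H - 1 / 2) - x ≤ _) ∧
          (_ ≤ (H - C * (2 - H)) / S - 1 / 2 - y ∧ (H - C * (2 - H)) / S - 1 / 2 - y ≤ _)
        constructor <;> constructor <;> linarith⟩
    · exact ⟨7, by
        change (_ ≤ (H - 1 / 2) - x ∧ (H - 1 / 2) - x ≤ _) ∧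
          (_ ≤ (S * (2 - H) - H) / C + 1 / 2 - y ∧ (S * (2 - H) - H) / C + 1 / 2 - y ≤ _)
        constructor <;> constructor <;> linarith⟩

/-- The octagon for an arbitrary angle: if the sine and cosine have different signs, they exchange
their roles. -/
lemma exists_pierce_octagon' {C S : ℝ} (h1 : C ^ 2 + S ^ 2 = 1) :
    ∃ z : Fin 8 → ℝ × ℝ, ∀ x y : ℝ, |x| ≤ (1 + |C| + |S|) / 2 → |y| ≤ (1 + |C| + |S|) / 2 →
      |C * x + S * y| ≤ (1 + |C| + |S|) / 2 → |-S * x + C * y| ≤ (1 + |C| + |S|) / 2 →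
        ∃ k, |(z k).1 - x| ≤ 1 / 2 ∧ |(z k).2 - y| ≤ 1 / 2 := by
  have h2 : |C| ^ 2 + |S| ^ 2 = 1 := by simpa using h1
  obtain ⟨z, hz⟩ := exists_pierce_octagon (abs_nonneg C) (abs_nonneg S) h2 rfl
  obtain ⟨z', hz'⟩ := exists_pierce_octagon (abs_nonneg S) (abs_nonneg C)
    (by linarith) (H := (1 + |C| + |S|) / 2) (by ring)
  rcases le_total 0 C with hC | hC <;> rcases le_total 0 S with hS | hS
  · refine ⟨z, fun x y hx hy hu hv => hz x y hx hy ?_ ?_⟩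
    · rwa [abs_of_nonneg hC, abs_of_nonneg hS] at *
    · rwa [abs_of_nonneg hC, abs_of_nonneg hS] at *
  · refine ⟨z', fun x y hx hy hu hv => hz' x y hx hy ?_ ?_⟩
    · rw [abs_of_nonneg hC, abs_of_nonpos hS] at *
      exact hv
    · rw [abs_of_nonneg hC, abs_of_nonpos hS] at *
      rw [← abs_neg]
      convert hu using 2
      ring
  · refine ⟨z', fun x y hx hy hu hv => hz' x y hx hy ?_ ?_⟩
    · rw [abs_of_nonpos hC, abs_of_nonneg hS] at *
      rw [← abs_neg]
      convert hv using 2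
      ring
    · rw [abs_of_nonpos hC, abs_of_nonneg hS] at *
      convert hu using 2
      ring
  · refine ⟨z, fun x y hx hy hu hv => hz x y hx hy ?_ ?_⟩
    · rw [abs_of_nonpos hC, abs_of_nonpos hS] at *
      rw [← abs_neg]
      convert hu using 2
      ring
    · rw [abs_of_nonpos hC, abs_of_nonpos hS] at *
      rw [← abs_neg]
      convert hv using 2
      ring

/-- An interval that contains `q` and has length at least `a` contains an interval of length `a`
that contains `q`, if `a` is not negative; `m` is its midpoint. -/
lemma exists_mid {α s a q : ℝ} (has : a ≤ s) (h1 : α ≤ q) (h2 : q ≤ α + s) :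
    ∃ m, α + a / 2 ≤ m ∧ m ≤ α + s - a / 2 ∧ |m - q| ≤ a / 2 ∨ a < 0 := by
  rcases lt_or_ge a 0 with ha | ha
  · exact ⟨0, Or.inr ha⟩
  refine ⟨max (α + a / 2) (min q (α + s - a / 2)), Or.inl ⟨le_max_left _ _, ?_, ?_⟩⟩
  · exact max_le (by linarith) (min_le_right _ _)
  · rw [abs_le]
    constructor
    · have : q - a / 2 ≤ max (α + a / 2) (min q (α + s - a / 2)) :=
        le_max_of_le_right (le_min (by linarith) (by linarith))
      linarith
    · have : max (α + a / 2) (min q (α + s - a / 2)) ≤ q + a / 2 :=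
        max_le (by linarith) ((min_le_left _ _).trans (by linarith))
      linarith

/-- Eight points pierce all closed axis-parallel squares that meet a given rotated closed square of
side length `a` and whose side length is at least `a`. -/
lemma exists_pierce {C S : ℝ} (h1 : C ^ 2 + S ^ 2 = 1) {a : ℝ} (ha : 0 < a) (c : ℝ × ℝ) :
    ∃ z : Fin 8 → ℝ × ℝ, ∀ α β s : ℝ, a ≤ s → ∀ q : ℝ × ℝ,
      α ≤ q.1 → q.1 ≤ α + s → β ≤ q.2 → q.2 ≤ β + s →
      |C * (q.1 - c.1) + S * (q.2 - c.2)| ≤ a / 2 → |-S * (q.1 - c.1) + C * (q.2 - c.2)| ≤ a / 2 →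
        ∃ k, α ≤ (z k).1 ∧ (z k).1 ≤ α + s ∧ β ≤ (z k).2 ∧ (z k).2 ≤ β + s := by
  obtain ⟨z, hz⟩ := exists_pierce_octagon' h1
  refine ⟨fun k => (c.1 + a * (z k).1, c.2 + a * (z k).2), ?_⟩
  intro α β s has q q1 q2 q3 q4 hu hv
  obtain ⟨m, ⟨m1, m2, m3⟩ | h⟩ := exists_mid has q1 q2
  swap
  · linarith
  obtain ⟨m', ⟨m1', m2', m3'⟩ | h⟩ := exists_mid has q3 q4
  swap
  · linarith
  have bound : ∀ t r : ℝ, |r| ≤ a / 2 → |t * r| ≤ |t| * (a / 2) := fun t r hr => by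
    rw [abs_mul]
    exact mul_le_mul_of_nonneg_left hr (abs_nonneg t)
  have b1 := abs_le.1 (bound C _ hu)
  have b2 := abs_le.1 (bound S _ hv)
  have b3 := abs_le.1 (bound S _ hu)
  have b4 := abs_le.1 (bound C _ hv)
  have b5 := abs_le.1 (bound C _ m3)
  have b6 := abs_le.1 (bound S _ m3')
  have b7 := abs_le.1 (bound S _ m3)
  have b8 := abs_le.1 (bound C _ m3')
  have ex : q.1 - c.1 = C * (C * (q.1 - c.1) + S * (q.2 - c.2)) -
      S * (-S * (q.1 - c.1) + C * (q.2 - c.2)) := by linear_combination -(q.1 - c.1) * h1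
  have ey : q.2 - c.2 = S * (C * (q.1 - c.1) + S * (q.2 - c.2)) +
      C * (-S * (q.1 - c.1) + C * (q.2 - c.2)) := by linear_combination -(q.2 - c.2) * h1
  have a3 := abs_le.1 m3
  have a3' := abs_le.1 m3'
  have au := abs_le.1 hu
  have av := abs_le.1 hv
  have scale : ∀ r : ℝ, |r| ≤ a * ((1 + |C| + |S|) / 2) → |r / a| ≤ (1 + |C| + |S|) / 2 := by
    intro r hr
    rw [abs_div, abs_of_pos ha, div_le_iff₀ ha]
    linarith
  obtain ⟨k, k1, k2⟩ := hz ((m - c.1) / a) ((m' - c.2) / a)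
    (scale _ (abs_le.2 ⟨by linarith, by linarith⟩))
    (scale _ (abs_le.2 ⟨by linarith, by linarith⟩))
    (by
      have : C * ((m - c.1) / a) + S * ((m' - c.2) / a) =
        (C * (m - c.1) + S * (m' - c.2)) / a := by ring
      rw [this]
      exact scale _ (abs_le.2 ⟨by linarith, by linarith⟩))
    (by
      have : -S * ((m - c.1) / a) + C * ((m' - c.2) / a) =
        (-S * (m - c.1) + C * (m' - c.2)) / a := by ring
      rw [this]
      exact scale _ (abs_le.2 ⟨by linarith, by linarith⟩))
  have unscale : ∀ t r : ℝ, |t - r / a| ≤ 1 / 2 → |a * t - r| ≤ a / 2 := by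
    intro t r h
    have : a * t - r = a * (t - r / a) := by field_simp
    rw [this, abs_mul, abs_of_pos ha]
    nlinarith
  have k1 := abs_le.1 (unscale _ _ k1)
  have k2 := abs_le.1 (unscale _ _ k2)
  exact ⟨k, by dsimp only; linarith, by dsimp only; linarith, by dsimp only; linarith,
    by dsimp only; linarith⟩

/-- If the axis-parallel squares are larger than the rotated square by a fixed amount, then they
contain one of the eight points at a distance from their sides that is bounded below. -/
lemma exists_pierce_margin {C S : ℝ} (h1 : C ^ 2 + S ^ 2 = 1) {a a' : ℝ} (ha : 0 < a)
    (haa : a < a') (c : ℝ × ℝ) :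
    ∃ ε > 0, ∃ z : Fin 8 → ℝ × ℝ, ∀ α β s : ℝ, a' ≤ s → ∀ q : ℝ × ℝ,
      α ≤ q.1 → q.1 ≤ α + s → β ≤ q.2 → q.2 ≤ β + s →
      |C * (q.1 - c.1) + S * (q.2 - c.2)| ≤ a / 2 → |-S * (q.1 - c.1) + C * (q.2 - c.2)| ≤ a / 2 →
        ∃ k, α + ε ≤ (z k).1 ∧ (z k).1 ≤ α + s - ε ∧ β + ε ≤ (z k).2 ∧ (z k).2 ≤ β + s - ε := by
  have hC : |C| ≤ 1 := abs_le_one_iff_mul_self_le_one.2 (by nlinarith [sq_nonneg S])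
  have hS : |S| ≤ 1 := abs_le_one_iff_mul_self_le_one.2 (by nlinarith [sq_nonneg C])
  obtain ⟨ε, hε, hεa⟩ : ∃ ε > 0, a + 6 * ε ≤ a' := ⟨(a' - a) / 6, by linarith, by linarith⟩
  -- Both squares are changed by `ε`: the fixed one grows and the others shrink.
  obtain ⟨z, hz⟩ := exists_pierce h1 (show 0 < a + 4 * ε by linarith) c
  refine ⟨ε, hε, z, fun α β s has q q1 q2 q3 q4 hu hv => ?_⟩
  have clamp : ∀ α r : ℝ, α ≤ r → r ≤ α + s →
      ∃ r', α + ε ≤ r' ∧ r' ≤ α + ε + (s - 2 * ε) ∧ |r' - r| ≤ ε := by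
    intro α r h1 h2
    obtain ⟨m, ⟨m1, m2, m3⟩ | h⟩ := exists_mid (a := 2 * ε) (by linarith) h1 h2
    · exact ⟨m, by linarith, by linarith, by linarith⟩
    · linarith
  obtain ⟨r, r1, r2, r3⟩ := clamp α q.1 q1 q2
  obtain ⟨t, t1, t2, t3⟩ := clamp β q.2 q3 q4
  have bound : ∀ A x : ℝ, |A| ≤ 1 → |x| ≤ ε → |A * x| ≤ ε := fun A x hA hx => by
    rw [abs_mul]
    nlinarith [abs_nonneg x]
  have b1 := abs_le.1 (bound C _ hC r3)
  have b2 := abs_le.1 (bound S _ hS t3)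
  have b3 := abs_le.1 (bound S _ hS r3)
  have b4 := abs_le.1 (bound C _ hC t3)
  have au := abs_le.1 hu
  have av := abs_le.1 hv
  obtain ⟨k, k1, k2, k3, k4⟩ := hz (α + ε) (β + ε) (s - 2 * ε) (by linarith) (r, t) r1 r2 t1 t2
    (abs_le.2 ⟨by dsimp only; linarith, by dsimp only; linarith⟩)
    (abs_le.2 ⟨by dsimp only; linarith, by dsimp only; linarith⟩)
  exact ⟨k, k1, by linarith, k3, by linarith⟩

variable {g : Plane → ℝ}

/-! ### Squares in the plane and their values -/

/-- The coordinate of `x` along the first side of a square with corner `p` and direction `θ`. -/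
noncomputable def cX (p : Plane) (θ : ℝ) (x : Plane) : ℝ :=
  (x 0 - p 0) * Real.cos θ + (x 1 - p 1) * Real.sin θ

/-- The coordinate of `x` along the second side of a square with corner `p` and direction `θ`. -/
noncomputable def cY (p : Plane) (θ : ℝ) (x : Plane) : ℝ :=
  -(x 0 - p 0) * Real.sin θ + (x 1 - p 1) * Real.cos θ

/-- The point with coordinates `(α, β)` in the frame with origin `p` and direction `θ`. -/
noncomputable def framePt (p : Plane) (θ α β : ℝ) : Plane :=
  p + α • !₂[Real.cos θ, Real.sin θ] + β • !₂[-Real.sin θ, Real.cos θ]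

lemma framePt_zero (p : Plane) (θ α β : ℝ) :
    framePt p θ α β 0 = p 0 + α * Real.cos θ - β * Real.sin θ := by
  simp [framePt]
  ring

lemma framePt_one (p : Plane) (θ α β : ℝ) :
    framePt p θ α β 1 = p 1 + α * Real.sin θ + β * Real.cos θ := by
  simp [framePt]

lemma framePt_cX_cY (p : Plane) (θ : ℝ) (x : Plane) : framePt p θ (cX p θ x) (cY p θ x) = x := by
  ext i
  fin_cases i
  · change framePt _ _ _ _ 0 = x 0
    rw [framePt_zero, cX, cY]
    linear_combination (x 0 - p 0) * Real.cos_sq_add_sin_sq θ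
  · change framePt _ _ _ _ 1 = x 1
    rw [framePt_one, cX, cY]
    linear_combination (x 1 - p 1) * Real.cos_sq_add_sin_sq θ

lemma cX_framePt_left (p : Plane) (θ α β : ℝ) (x : Plane) :
    cX (framePt p θ α β) θ x = cX p θ x - α := by
  rw [cX, cX, framePt_zero, framePt_one]
  linear_combination -α * Real.cos_sq_add_sin_sq θ

lemma cY_framePt_left (p : Plane) (θ α β : ℝ) (x : Plane) :
    cY (framePt p θ α β) θ x = cY p θ x - β := by
  rw [cY, cY, framePt_zero, framePt_one]
  linear_combination -β * Real.cos_sq_add_sin_sq θ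

lemma cX_framePt (p : Plane) (θ α β : ℝ) : cX p θ (framePt p θ α β) = α := by
  have := cX_framePt_left p θ α β (framePt p θ α β)
  simp only [cX, sub_self, zero_mul, add_zero] at this ⊢
  linarith

lemma cY_framePt (p : Plane) (θ α β : ℝ) : cY p θ (framePt p θ α β) = β := by
  have := cY_framePt_left p θ α β (framePt p θ α β)
  simp only [cY, sub_self, zero_mul, add_zero, neg_zero] at this ⊢
  linarith

lemma mem_openSquare {p x : Plane} {a θ : ℝ} :
    x ∈ openSquare p a θ ↔ (0 < cX p θ x ∧ cX p θ x < a) ∧ (0 < cY p θ x ∧ cY p θ x < a) := by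
  constructor
  · rintro ⟨s, hs, t, ht, h⟩
    have h : x = framePt p θ s t := h
    rw [h, cX_framePt, cY_framePt]
    exact ⟨hs, ht⟩
  · rintro ⟨h1, h2⟩
    exact ⟨_, h1, _, h2, (framePt_cX_cY p θ x).symm⟩

/-- The open square with the corner, side length and direction recorded in `q`. -/
def sq (q : Plane × ℝ × ℝ) : Set Plane := openSquare q.1 q.2.1 q.2.2

lemma mem_sq {q : Plane × ℝ × ℝ} {x : Plane} :
    x ∈ sq q ↔ (0 < cX q.1 q.2.2 x ∧ cX q.1 q.2.2 x < q.2.1) ∧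
      (0 < cY q.1 q.2.2 x ∧ cY q.1 q.2.2 x < q.2.1) := mem_openSquare

lemma continuous_cX : Continuous fun t : (Plane × ℝ × ℝ) × Plane => cX t.1.1 t.1.2.2 t.2 := by
  unfold cX
  fun_prop

lemma continuous_cY : Continuous fun t : (Plane × ℝ × ℝ) × Plane => cY t.1.1 t.1.2.2 t.2 := by
  unfold cY
  fun_prop

lemma isOpen_setOf_mem_sq : IsOpen {t : (Plane × ℝ × ℝ) × Plane | t.2 ∈ sq t.1} := by
  simp only [mem_sq]
  exact ((isOpen_lt continuous_const continuous_cX).inter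
    (isOpen_lt continuous_cX (by fun_prop))).inter
    ((isOpen_lt continuous_const continuous_cY).inter (isOpen_lt continuous_cY (by fun_prop)))

lemma isOpen_sq (q : Plane × ℝ × ℝ) : IsOpen (sq q) :=
  isOpen_setOf_mem_sq.preimage (f := fun x => (q, x)) (by fun_prop)

lemma isOpen_setOf_sq_mem (x : Plane) : IsOpen {q | x ∈ sq q} :=
  isOpen_setOf_mem_sq.preimage (f := fun q => (q, x)) (by fun_prop)

/-- Lines in the plane are null sets. -/
lemma volume_line {A B c : ℝ} (h : A ^ 2 + B ^ 2 = 1) :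
    volume {x : Plane | A * x 0 + B * x 1 = c} = 0 := by
  let E : AffineSubspace ℝ Plane :=
    { carrier := {x : Plane | A * x 0 + B * x 1 = c}
      smul_vsub_vadd_mem' := by
        intro k x y z hx hy hz
        change A * _ + B * _ = c at hx hy hz
        change A * _ + B * _ = c
        simp only [vsub_eq_sub, vadd_eq_add, PiLp.add_apply, PiLp.smul_apply, PiLp.sub_apply,
          smul_eq_mul]
        linear_combination k * hx - k * hy + hz }
  refine Measure.addHaar_affineSubspace volume E fun e => ?_
  have : (!₂[A * (c + 1), B * (c + 1)] : Plane) ∈ E := by rw [e]; exact AffineSubspace.mem_top ..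
  have h' : A * (A * (c + 1)) + B * (B * (c + 1)) = c := this
  have : A * (A * (c + 1)) + B * (B * (c + 1)) = c + 1 := by linear_combination (c + 1) * h
  linarith

lemma ae_cX_ne (p : Plane) (θ c : ℝ) : ∀ᵐ x, cX p θ x ≠ c := by
  rw [ae_iff]
  convert volume_line (A := Real.cos θ) (B := Real.sin θ)
    (c := c + p 0 * Real.cos θ + p 1 * Real.sin θ) (Real.cos_sq_add_sin_sq θ) using 2
  ext x
  simp only [not_not, cX, Set.mem_ofPred_eq]
  constructor <;> intro h <;> linarith

lemma ae_cY_ne (p : Plane) (θ c : ℝ) : ∀ᵐ x, cY p θ x ≠ c := by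
  rw [ae_iff]
  convert volume_line (A := -Real.sin θ) (B := Real.cos θ)
    (c := c - p 0 * Real.sin θ + p 1 * Real.cos θ)
    (by linear_combination Real.cos_sq_add_sin_sq θ) using 2
  ext x
  simp only [not_not, cY, Set.mem_ofPred_eq]
  constructor <;> intro h <;> linarith


lemma value_sq_eq (g : Plane → ℝ) (q : Plane × ℝ × ℝ) :
    value g (sq q) = ∫ x, (sq q).indicator g x :=
  (integral_indicator (isOpen_sq q).measurableSet).symm

/-- The value of a square depends continuously on the square. -/
lemma continuous_value_sq (hg : Integrable g) : Continuous fun q => value g (sq q) := by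
  simp only [value_sq_eq]
  rw [continuous_iff_continuousAt]
  intro q
  refine continuousAt_of_dominated (bound := fun x => ‖g x‖) ?_ ?_ hg.norm ?_
  · exact Eventually.of_forall fun q =>
      (hg.indicator (isOpen_sq q).measurableSet).aestronglyMeasurable
  · exact Eventually.of_forall fun q => Eventually.of_forall fun x => norm_indicator_le_norm_self _ _
  · filter_upwards [ae_cX_ne q.1 q.2.2 0, ae_cX_ne q.1 q.2.2 q.2.1, ae_cY_ne q.1 q.2.2 0,
      ae_cY_ne q.1 q.2.2 q.2.1] with x h1 h2 h3 h4
    have cx : Continuous fun q : Plane × ℝ × ℝ => cX q.1 q.2.2 x :=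
      continuous_cX.comp (f := fun q => (q, x)) (by fun_prop)
    have cy : Continuous fun q : Plane × ℝ × ℝ => cY q.1 q.2.2 x :=
      continuous_cY.comp (f := fun q => (q, x)) (by fun_prop)
    have cs : Continuous fun q : Plane × ℝ × ℝ => q.2.1 := by fun_prop
    -- A point off the boundary stays inside, or outside, under small changes of the square.
    have key : (∀ᶠ q' in 𝓝 q, x ∈ sq q') ∨ ∀ᶠ q' in 𝓝 q, x ∉ sq q' := by
      by_cases hx : x ∈ sq q
      · exact Or.inl ((isOpen_setOf_sq_mem x).mem_nhds hx)
      · right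
        rw [mem_sq] at hx
        simp only [mem_sq]
        rcases lt_or_gt_of_ne h1 with e | e
        · filter_upwards [(isOpen_lt cx continuous_const).mem_nhds e] with q' e' h
          exact lt_asymm e' h.1.1
        rcases lt_or_gt_of_ne h2 with e2 | e2
        swap
        · filter_upwards [(isOpen_lt cs cx).mem_nhds e2] with q' e' h
          exact lt_asymm e' h.1.2
        rcases lt_or_gt_of_ne h3 with e3 | e3
        · filter_upwards [(isOpen_lt cy continuous_const).mem_nhds e3] with q' e' h
          exact lt_asymm e' h.2.1
        rcases lt_or_gt_of_ne h4 with e4 | e4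
        · exact (hx ⟨⟨e, e2⟩, e3, e4⟩).elim
        · filter_upwards [(isOpen_lt cs cy).mem_nhds e4] with q' e' h
          exact lt_asymm e' h.2.2
    rcases key with key | key
    · refine (continuousAt_const (y := g x)).congr ?_
      filter_upwards [key] with q' h using (Set.indicator_of_mem h g).symm
    · refine (continuousAt_const (y := (0 : ℝ))).congr ?_
      filter_upwards [key] with q' h using (Set.indicator_of_notMem h g).symm

lemma sq_eq_empty {q : Plane × ℝ × ℝ} (h : q.2.1 ≤ 0) : sq q = ∅ := by
  ext x
  simp only [mem_sq, Set.mem_empty_iff_false, iff_false]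
  intro hx
  linarith [hx.1.1, hx.1.2]

lemma side_pos_of_value_pos {q : Plane × ℝ × ℝ} (h : 0 < value g (sq q)) : 0 < q.2.1 := by
  by_contra! hc
  rw [sq_eq_empty hc] at h
  simp [value] at h

lemma sq_subset_sq_of_side_le {p : Plane} {a b θ : ℝ} (h : a ≤ b) : sq (p, a, θ) ⊆ sq (p, b, θ) := by
  intro x hx
  rw [mem_sq] at hx ⊢
  dsimp only at hx ⊢
  exact ⟨⟨hx.1.1, hx.1.2.trans_le h⟩, hx.2.1, hx.2.2.trans_le h⟩

lemma isClosed_setOf_sq_subset (D : Set Plane) : IsClosed {q | sq q ⊆ D} := by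
  have : {q | sq q ⊆ D} = ⋂ x ∈ Dᶜ, {q | x ∈ sq q}ᶜ := by
    ext q
    simp only [Set.mem_ofPred_eq, Set.mem_iInter, Set.mem_compl_iff]
    exact ⟨fun h x hx hq => hx (h hq), fun h x hq => by_contra fun hx => h x hx hq⟩
  rw [this]
  exact isClosed_biInter fun x _ => (isOpen_setOf_sq_mem x).isClosed_compl

lemma isClosed_setOf_disjoint_sq :
    IsClosed {t : (Plane × ℝ × ℝ) × (Plane × ℝ × ℝ) | Disjoint (sq t.1) (sq t.2)} := by
  have : {t : (Plane × ℝ × ℝ) × (Plane × ℝ × ℝ) | Disjoint (sq t.1) (sq t.2)} =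
      ⋂ x, ({t | x ∈ sq t.1} ∩ {t | x ∈ sq t.2})ᶜ := by
    ext t
    simp only [Set.disjoint_left, Set.mem_iInter, Set.mem_compl_iff, Set.mem_inter_iff,
      Set.mem_ofPred_eq, not_and]
  rw [this]
  exact isClosed_iInter fun x => (((isOpen_setOf_sq_mem x).preimage continuous_fst).inter
    ((isOpen_setOf_sq_mem x).preimage continuous_snd)).isClosed_compl

/-- The corner of a square lies in every closed set that contains the square, and its side length
is bounded by the diameter of the set. -/
lemma mem_and_side_le {C : Set Plane} (hC : IsCompact C) {q : Plane × ℝ × ℝ} (hq : 0 < q.2.1)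
    (hs : sq q ⊆ C) : q.1 ∈ C ∧ q.2.1 ≤ Metric.diam C := by
  obtain ⟨p, a, θ⟩ := q
  have hcl : ∀ f : ℝ → Plane, Continuous f → (∀ r ∈ Set.Ioo 0 a, f r ∈ sq (p, a, θ)) →
      f 0 ∈ C := by
    intro f hf h
    refine hC.isClosed.mem_of_tendsto
      ((hf.tendsto 0).mono_left (nhdsWithin_le_nhds (s := Set.Ioi 0))) ?_
    filter_upwards [Ioo_mem_nhdsGT hq] with r hr using hs (h r hr)
  have h0 : framePt p θ 0 0 ∈ C :=
    hcl (fun r => framePt p θ r r) (by unfold framePt; fun_prop) fun r hr => by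
    rw [mem_sq, cX_framePt, cY_framePt]
    exact ⟨hr, hr⟩
  have h1 : framePt p θ (a - 0) 0 ∈ C :=
    hcl (fun r => framePt p θ (a - r) r) (by unfold framePt; fun_prop) fun r hr => by
    rw [mem_sq, cX_framePt, cY_framePt]
    exact ⟨⟨by linarith [hr.2], by linarith [hr.1]⟩, hr⟩
  refine ⟨by simpa [framePt] using h0, ?_⟩
  have hd := Metric.dist_le_diam_of_mem hC.isBounded h1 h0
  rw [EuclideanSpace.dist_eq, Fin.sum_univ_two, Real.dist_eq, Real.dist_eq, framePt_zero,
    framePt_zero, framePt_one, framePt_one, sq_abs, sq_abs] at hd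
  have : (p 0 + (a - 0) * Real.cos θ - 0 * Real.sin θ - (p 0 + 0 * Real.cos θ - 0 * Real.sin θ)) ^ 2
      + (p 1 + (a - 0) * Real.sin θ + 0 * Real.cos θ - (p 1 + 0 * Real.sin θ + 0 * Real.cos θ)) ^ 2
      = a ^ 2 := by linear_combination a ^ 2 * Real.cos_sq_add_sin_sq θ
  rw [this, Real.sqrt_sq hq.le] at hd
  exact hd

/-- A compact set of parameters that suffices for the squares in a compact set `C`. It also contains
degenerate parameters with side length `0`, for which the square is empty. -/
def box (C : Set Plane) : Set (Plane × ℝ × ℝ) :=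
  C ×ˢ (Set.Icc 0 (Metric.diam C) ×ˢ Set.Icc 0 (2 * Real.pi))

lemma isCompact_box {C : Set Plane} (hC : IsCompact C) : IsCompact (box C) :=
  hC.prod (isCompact_Icc.prod isCompact_Icc)

lemma exists_mem_box {C : Set Plane} (hC : IsCompact C) {q : Plane × ℝ × ℝ} (hq : 0 < q.2.1)
    (hs : sq q ⊆ C) : ∃ q' ∈ box C, q'.2.1 = q.2.1 ∧ sq q' = sq q := by
  obtain ⟨p, a, θ⟩ := q
  obtain ⟨h1, h2⟩ := mem_and_side_le hC hq hs
  have hm := toIcoMod_mem_Ico Real.two_pi_pos 0 θ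
  refine ⟨(p, a, toIcoMod Real.two_pi_pos 0 θ), ⟨h1, ⟨hq.le, h2⟩, hm.1, ?_⟩, rfl, ?_⟩
  · simpa using hm.2.le
  · have e : toIcoMod Real.two_pi_pos 0 θ = θ - toIcoDiv Real.two_pi_pos 0 θ * (2 * Real.pi) := by
      rw [toIcoMod, zsmul_eq_mul]
    simp only [sq, openSquare, e, Real.cos_sub_int_mul_two_pi, Real.sin_sub_int_mul_two_pi]

/-- Among the squares in `D` that have value at least `t`, there is one with the least side
length. -/
lemma exists_min_side {C D : Set Plane} (hC : IsCompact C) (hD : D ⊆ C) (hg : Integrable g) {t : ℝ}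
    (ht : 0 < t) (hne : ∃ q, sq q ⊆ D ∧ t ≤ value g (sq q)) :
    ∃ q, sq q ⊆ D ∧ t ≤ value g (sq q) ∧
      ∀ q', sq q' ⊆ D → t ≤ value g (sq q') → q.2.1 ≤ q'.2.1 := by
  have lift : ∀ q, sq q ⊆ D → t ≤ value g (sq q) →
      ∃ q' ∈ box C ∩ ({q | sq q ⊆ D} ∩ {q | t ≤ value g (sq q)}), q'.2.1 = q.2.1 := by
    intro q h1 h2
    obtain ⟨q', hb, e1, e2⟩ :=
      exists_mem_box hC (side_pos_of_value_pos (ht.trans_le h2)) (h1.trans hD)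
    exact ⟨q', ⟨hb, (e2 ▸ h1 : sq q' ⊆ D), (e2 ▸ h2 : t ≤ value g (sq q'))⟩, e1⟩
  have hK : IsCompact (box C ∩ ({q | sq q ⊆ D} ∩ {q | t ≤ value g (sq q)})) :=
    (isCompact_box hC).inter_right ((isClosed_setOf_sq_subset D).inter
      (isClosed_le continuous_const (continuous_value_sq hg)))
  obtain ⟨q0, h1, h2⟩ := hne
  obtain ⟨q1, hq1, -⟩ := lift q0 h1 h2
  obtain ⟨q, ⟨-, hq, hqt⟩, hmin⟩ := hK.exists_isMinOn ⟨q1, hq1⟩ (f := fun q => q.2.1) (by fun_prop)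
  refine ⟨q, hq, hqt, fun q' h1 h2 => ?_⟩
  obtain ⟨q2, hq2, e⟩ := lift q' h1 h2
  rw [← e]
  exact hmin hq2

/-! ### A valuable square among obstacles -/


lemma mem_sq_framePt {p x : Plane} {θ α β s : ℝ} : x ∈ sq (framePt p θ α β, s, θ) ↔
    (α < cX p θ x ∧ cX p θ x < α + s) ∧ (β < cY p θ x ∧ cY p θ x < β + s) := by
  rw [mem_sq, cX_framePt_left, cY_framePt_left, sub_pos, sub_pos, sub_lt_iff_lt_add',
    sub_lt_iff_lt_add']

/-- For squares with the direction `θ` and a side length that exceeds that of the square `X` by at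
least `δ`, there are eight sites, in the coordinates of the frame `p, θ`, such that each of these
squares meeting `X` contains one of the sites well inside. -/
lemma exists_pierce_sq (p : Plane) (θ : ℝ) {X : Plane × ℝ × ℝ} (hX : 0 < X.2.1) {δ : ℝ}
    (hδ : 0 < δ) :
    ∃ ε > 0, ∃ F : Finset (ℝ × ℝ), F.card ≤ 8 ∧ ∀ α β s : ℝ, X.2.1 + δ ≤ s →
      ¬ Disjoint (sq (framePt p θ α β, s, θ)) (sq X) →
        ∃ z ∈ F, α + ε ≤ z.1 ∧ z.1 ≤ α + s - ε ∧ β + ε ≤ z.2 ∧ z.2 ≤ β + s - ε := by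
  classical
  obtain ⟨r, a, φ⟩ := X
  set C := Real.cos (φ - θ) with hC
  set S := Real.sin (φ - θ) with hS
  have h1 : C ^ 2 + S ^ 2 = 1 := Real.cos_sq_add_sin_sq _
  obtain ⟨ε, hε, z, hz⟩ := exists_pierce_margin h1 hX (show a < a + δ by linarith)
    (cX p θ r + a / 2 * (C - S), cY p θ r + a / 2 * (S + C))
  refine ⟨ε, hε, Finset.univ.image z, Finset.card_image_le.trans (by simp), ?_⟩
  intro α β s hs hd
  obtain ⟨x, hxP, hxX⟩ := Set.not_disjoint_iff.1 hd
  rw [mem_sq_framePt] at hxP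
  rw [mem_sq] at hxX
  dsimp only at hxX
  have e1 : C * (cX p θ x - (cX p θ r + a / 2 * (C - S))) +
      S * (cY p θ x - (cY p θ r + a / 2 * (S + C))) = cX r φ x - a / 2 := by
    have : C * (cX p θ x - cX p θ r) + S * (cY p θ x - cY p θ r) = cX r φ x := by
      rw [hC, hS, Real.cos_sub, Real.sin_sub]
      unfold cX cY
      linear_combination ((x 0 - r 0) * Real.cos φ + (x 1 - r 1) * Real.sin φ) *
        Real.cos_sq_add_sin_sq θ
    linear_combination this - a / 2 * h1
  have e2 : -S * (cX p θ x - (cX p θ r + a / 2 * (C - S))) +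
      C * (cY p θ x - (cY p θ r + a / 2 * (S + C))) = cY r φ x - a / 2 := by
    have : -S * (cX p θ x - cX p θ r) + C * (cY p θ x - cY p θ r) = cY r φ x := by
      rw [hC, hS, Real.cos_sub, Real.sin_sub]
      unfold cX cY
      linear_combination (-(x 0 - r 0) * Real.sin φ + (x 1 - r 1) * Real.cos φ) *
        Real.cos_sq_add_sin_sq θ
    linear_combination this - a / 2 * h1
  obtain ⟨k, hk⟩ := hz α β s hs (cX p θ x, cY p θ x) hxP.1.1.le hxP.1.2.le hxP.2.1.le hxP.2.2.le
    (by rw [e1, abs_le]; constructor <;> linarith [hxX.1.1, hxX.1.2])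
    (by rw [e2, abs_le]; constructor <;> linarith [hxX.2.1, hxX.2.2])
  exact ⟨z k, Finset.mem_image_of_mem z (Finset.mem_univ k), hk⟩

lemma exists_pierce_list (p : Plane) (θ : ℝ) {δ : ℝ} (hδ : 0 < δ) (O : List (Plane × ℝ × ℝ))
    (hO : ∀ X ∈ O, 0 < X.2.1) :
    ∃ ε > 0, ∃ F : Finset (ℝ × ℝ), F.card ≤ 8 * O.length ∧ ∀ X ∈ O, ∀ α β s : ℝ,
      X.2.1 + δ ≤ s → ¬ Disjoint (sq (framePt p θ α β, s, θ)) (sq X) →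
        ∃ z ∈ F, α + ε ≤ z.1 ∧ z.1 ≤ α + s - ε ∧ β + ε ≤ z.2 ∧ z.2 ≤ β + s - ε := by
  classical
  induction O with
  | nil => exact ⟨1, one_pos, ∅, by simp, by simp⟩
  | cons Y O ih =>
    obtain ⟨ε, hε, F, hF, h⟩ := ih fun X hX => hO X (List.mem_cons_of_mem _ hX)
    obtain ⟨ε', hε', F', hF', h'⟩ := exists_pierce_sq p θ (hO Y List.mem_cons_self) hδ
    refine ⟨min ε ε', lt_min hε hε', F ∪ F', ?_, ?_⟩
    · rw [List.length_cons]
      exact (Finset.card_union_le F F').trans (by omega)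
    · intro X hX α β s hs hd
      rcases List.mem_cons.1 hX with rfl | hX
      · obtain ⟨z, hz, h1, h2, h3, h4⟩ := h' α β s hs hd
        have := min_le_right ε ε'
        exact ⟨z, Finset.mem_union_right _ hz, by linarith, by linarith, by linarith, by linarith⟩
      · obtain ⟨z, hz, h1, h2, h3, h4⟩ := h X hX α β s hs hd
        have := min_le_left ε ε'
        exact ⟨z, Finset.mem_union_left _ hz, by linarith, by linarith, by linarith, by linarith⟩

/-- The value of a square is at most the sum of the values of squares covering it, since boundaries
and finite sets have value zero. -/
lemma value_sq_le_sum (hg : Integrable g) (hg0 : 0 ≤ g) {p : Plane} {θ L : ℝ} {Z : Set (ℝ × ℝ)}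
    (hZ : Z.Finite) (Q : Finset (ℝ × ℝ × ℝ))
    (hQ : ∀ u ∈ Set.Ioo 0 L, ∀ v ∈ Set.Ioo 0 L, (u, v) ∉ Z →
        ∃ q ∈ Q, q.1 ≤ u ∧ u ≤ q.1 + q.2.2 ∧ q.2.1 ≤ v ∧ v ≤ q.2.1 + q.2.2) :
    value g (sq (p, L, θ)) ≤ ∑ q ∈ Q, value g (sq (framePt p θ q.1 q.2.1, q.2.2, θ)) := by
  simp only [value_sq_eq]
  have hi : ∀ q, Integrable ((sq q).indicator g) := fun q =>
    hg.indicator (isOpen_sq q).measurableSet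
  rw [← integral_finsetSum _ fun q _ => hi _]
  refine integral_mono_ae (hi _) (integrable_finsetSum _ fun q _ => hi _) ?_
  have aeZ : ∀ᵐ x, ∀ z ∈ Z, cX p θ x ≠ z.1 :=
    (ae_ball_iff hZ.countable).2 fun z _ => ae_cX_ne p θ z.1
  have aeQ : ∀ᵐ x, ∀ q ∈ Q, (cX p θ x ≠ q.1 ∧ cX p θ x ≠ q.1 + q.2.2) ∧
      cY p θ x ≠ q.2.1 ∧ cY p θ x ≠ q.2.1 + q.2.2 := by
    refine (ae_ball_iff Q.countable_toSet).2 fun q _ => ?_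
    filter_upwards [ae_cX_ne p θ q.1, ae_cX_ne p θ (q.1 + q.2.2), ae_cY_ne p θ q.2.1,
      ae_cY_ne p θ (q.2.1 + q.2.2)] with x h1 h2 h3 h4 using ⟨⟨h1, h2⟩, h3, h4⟩
  filter_upwards [aeZ, aeQ] with x hxZ hxQ
  have hpos : ∀ q, 0 ≤ (sq q).indicator g x := fun q => Set.indicator_nonneg (fun x _ => hg0 x) x
  by_cases hx : x ∈ sq (p, L, θ)
  · have hx' := mem_sq.1 hx
    dsimp only at hx'
    obtain ⟨q, hq, h1, h2, h3, h4⟩ := hQ _ hx'.1 _ hx'.2 fun h => hxZ _ h rfl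
    obtain ⟨⟨n1, n2⟩, n3, n4⟩ := hxQ q hq
    have hxq : x ∈ sq (framePt p θ q.1 q.2.1, q.2.2, θ) := mem_sq_framePt.2
      ⟨⟨lt_of_le_of_ne h1 n1.symm, lt_of_le_of_ne h2 n2⟩,
        lt_of_le_of_ne h3 n3.symm, lt_of_le_of_ne h4 n4⟩
    rw [Set.indicator_of_mem hx, ← Set.indicator_of_mem hxq g]
    exact Finset.single_le_sum
      (f := fun q : ℝ × ℝ × ℝ => (sq (framePt p θ q.1 q.2.1, q.2.2, θ)).indicator g x)
      (fun q _ => hpos _) hq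
  · rw [Set.indicator_of_notMem hx]
    exact Finset.sum_nonneg fun q _ => hpos _

/-- In a square, next to `k` obstacles, there is a square with at least the fraction
`1 / (16 * k + 2)` of the value, which avoids all obstacles that are smaller than it. -/
theorem exists_square_avoiding_smaller (hg : Integrable g) (hg0 : 0 ≤ g) {q : Plane × ℝ × ℝ}
    (hq : 0 < q.2.1) {δ : ℝ} (hδ : 0 < δ) (O : List (Plane × ℝ × ℝ)) (hO : ∀ X ∈ O, 0 < X.2.1) :
    ∃ P, sq P ⊆ sq q ∧ value g (sq q) ≤ (16 * O.length + 2) * value g (sq P) ∧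
      ∀ X ∈ O, X.2.1 + δ ≤ P.2.1 → Disjoint (sq P) (sq X) := by
  obtain ⟨p, L, θ⟩ := q
  have hL : 0 < L := hq
  obtain ⟨ε, hε, F, hF, hpierce⟩ := exists_pierce_list p θ hδ O hO
  obtain ⟨W, hWf, hWc, hWG, hWn⟩ := exists_isGeneric_near hL F hε
  set Z := W ∩ {z | z.1 ∈ Set.Ioo 0 L ∧ z.2 ∈ Set.Ioo 0 L} with hZ
  have hZf : Z.Finite := hWf.inter_of_left _
  obtain ⟨Q, hQc, hQ, hcov⟩ := exists_cover hL hZf (hWG.mono Set.inter_subset_left)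
    fun z hz => hz.2
  have hZc : Z.ncard ≤ 8 * O.length :=
    (Set.ncard_le_ncard Set.inter_subset_left hWf).trans (hWc.trans hF)
  have hsum := value_sq_le_sum hg hg0 (p := p) (θ := θ) hZf Q hcov
  have hnn : ∀ X : Set Plane, 0 ≤ value g X := fun X => integral_nonneg fun x => hg0 x
  -- Some square of the cover has at least the average value.
  obtain ⟨r, hr, hval⟩ : ∃ r ∈ Q, value g (sq (p, L, θ)) ≤
      (16 * O.length + 2) * value g (sq (framePt p θ r.1 r.2.1, r.2.2, θ)) := by
    have hQne : Q.Nonempty := by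
      obtain ⟨u, hu, huF⟩ := (Set.Ioo_infinite hL).exists_notMem_finite (hZf.image Prod.fst)
      obtain ⟨r, hr, -⟩ := hcov u hu u hu fun h => huF ⟨_, h, rfl⟩
      exact ⟨r, hr⟩
    obtain ⟨r, hr, hmax⟩ := Q.exists_max_image
      (fun r => value g (sq (framePt p θ r.1 r.2.1, r.2.2, θ))) hQne
    refine ⟨r, hr, hsum.trans ((Finset.sum_le_card_nsmul Q _ _ hmax).trans ?_)⟩
    rw [nsmul_eq_mul]
    refine mul_le_mul_of_nonneg_right ?_ (hnn _)
    have : Q.card ≤ 16 * O.length + 2 := by omega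
    exact_mod_cast this
  obtain ⟨hs, f1, f2, f3, f4, f5⟩ := hQ r hr
  refine ⟨(framePt p θ r.1 r.2.1, r.2.2, θ), ?_, hval, ?_⟩
  · intro x hx
    have hx := mem_sq_framePt.1 hx
    exact mem_sq.2 ⟨⟨by linarith [hx.1.1], hx.1.2.trans_le f3⟩, by linarith [hx.2.1],
      hx.2.2.trans_le f4⟩
  · intro X hX hside
    by_contra hd
    obtain ⟨z, hz, z1, z2, z3, z4⟩ := hpierce X hX _ _ _ hside hd
    obtain ⟨w, hw, w1, w2⟩ := hWn z hz
    rw [abs_lt] at w1 w2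
    have i1 : r.1 < w.1 := by linarith
    have i2 : w.1 < r.1 + r.2.2 := by linarith
    have i3 : r.2.1 < w.2 := by linarith
    have i4 : w.2 < r.2.1 + r.2.2 := by linarith
    exact f5 w ⟨hw, ⟨by linarith, by linarith⟩, by linarith, by linarith⟩ ⟨i1, i2, i3, i4⟩

/-! ### Serving the smallest square first -/

/-- The union of the squares in a list. -/
def covered (O : List (Plane × ℝ × ℝ)) : Set Plane := ⋃ X ∈ O, sq X

lemma subset_diff_covered {C : Set Plane} {O : List (Plane × ℝ × ℝ)} {q : Plane × ℝ × ℝ} :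
    sq q ⊆ C \ covered O ↔ sq q ⊆ C ∧ ∀ X ∈ O, Disjoint (sq q) (sq X) := by
  rw [Set.subset_sdiff, covered, Set.disjoint_iUnion₂_right]

/-- In the list of squares, whose head has been cut last, each square was at most as large, with a
margin of `δ`, as all squares of value at least `t` that were available when it was cut. -/
def IsChain (C : Set Plane) (g : Plane → ℝ) (t δ : ℝ) : List (Plane × ℝ × ℝ) → Prop
  | [] => True
  | X :: O => (∀ q, sq q ⊆ C \ covered O → t ≤ value g (sq q) → X.2.1 + δ ≤ q.2.1) ∧
      IsChain C g t δ O

lemma IsChain.mono {C : Set Plane} {t δ δ' : ℝ} (h : δ' ≤ δ) {O : List (Plane × ℝ × ℝ)}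
    (hO : IsChain C g t δ O) : IsChain C g t δ' O := by
  induction O with
  | nil => trivial
  | cons X O ih => exact ⟨fun q h1 h2 => by linarith [hO.1 q h1 h2], ih hO.2⟩

/-- For a higher threshold there is a positive margin, because a square whose value exceeds the
lower threshold may be shrunk. -/
lemma IsChain.exists_margin {C : Set Plane} (hC : IsCompact C) (hg : Integrable g) {t t' : ℝ}
    (ht : 0 < t) (htt : t < t') {O : List (Plane × ℝ × ℝ)} (hO : IsChain C g t 0 O) :
    ∃ δ > 0, IsChain C g t' δ O := by
  induction O with
  | nil => exact ⟨1, one_pos, trivial⟩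
  | cons X O ih =>
    obtain ⟨δ, hδ, h⟩ := ih hO.2
    suffices ∃ δ' > 0, ∀ q, sq q ⊆ C \ covered O → t' ≤ value g (sq q) → X.2.1 + δ' ≤ q.2.1 by
      obtain ⟨δ', hδ', h'⟩ := this
      refine ⟨min δ δ', lt_min hδ hδ', fun q h1 h2 => ?_, h.mono (min_le_left _ _)⟩
      linarith [h' q h1 h2, min_le_right δ δ']
    by_cases hne : ∃ q, sq q ⊆ C \ covered O ∧ t' ≤ value g (sq q)
    swap
    · exact ⟨1, one_pos, fun q h1 h2 => (hne ⟨q, h1, h2⟩).elim⟩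
    obtain ⟨⟨p, a, θ⟩, h1, h2, hmin⟩ :=
      exists_min_side hC Set.sdiff_subset hg (ht.trans htt) hne
    have hcont : Continuous fun b => value g (sq (p, b, θ)) :=
      (continuous_value_sq hg).comp (f := fun b => (p, b, θ)) (by fun_prop)
    have hev : ∀ᶠ b in 𝓝[<] a, t < value g (sq (p, b, θ)) :=
      Eventually.filter_mono nhdsWithin_le_nhds
        ((isOpen_lt continuous_const hcont).mem_nhds (htt.trans_le h2))
    obtain ⟨b, hb, hba⟩ := (hev.and self_mem_nhdsWithin).exists
    have hba : b < a := hba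
    have hX := hO.1 (p, b, θ) ((sq_subset_sq_of_side_le hba.le).trans h1) hb.le
    refine ⟨a - b, by linarith, fun q h3 h4 => ?_⟩
    have := hmin q h3 h4
    dsimp only at this hX
    linarith

/-- An agent who was not served by the squares in the list still has an acceptable square. -/
lemma IsChain.exists_available {C : Set Plane} (hC : IsCompact C) (hg : Integrable g) (hg0 : 0 ≤ g)
    {t : ℝ} (ht : 0 < t) {O : List (Plane × ℝ × ℝ)} (hpos : ∀ X ∈ O, 0 < X.2.1)
    (hO : IsChain C g t 0 O) {S : Plane × ℝ × ℝ} (hSC : sq S ⊆ C)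
    (hS : t * (16 * O.length + 2) < value g (sq S)) :
    ∃ q, sq q ⊆ C \ covered O ∧ t ≤ value g (sq q) := by
  have hk : (0 : ℝ) < 16 * O.length + 2 := by positivity
  have htt : t < value g (sq S) / (16 * O.length + 2) := by rwa [lt_div_iff₀ hk]
  obtain ⟨δ, hδ, hch⟩ := hO.exists_margin hC hg ht htt
  obtain ⟨P, hPS, hPv, hP⟩ := exists_square_avoiding_smaller hg hg0
    (side_pos_of_value_pos ((mul_pos ht hk).trans hS)) hδ O hpos
  have hPv' : value g (sq S) / (16 * O.length + 2) ≤ value g (sq P) := by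
    rw [div_le_iff₀ hk]
    linarith
  -- `P` avoids the squares one after another, since it was available when each of them was cut.
  have key : ∀ O' : List (Plane × ℝ × ℝ), IsChain C g (value g (sq S) / (16 * O.length + 2)) δ O' →
      (∀ X ∈ O', X.2.1 + δ ≤ P.2.1 → Disjoint (sq P) (sq X)) → sq P ⊆ C \ covered O' := by
    intro O' h1 h2
    induction O' with
    | nil => exact subset_diff_covered.2 ⟨hPS.trans hSC, by simp⟩
    | cons X O' ih =>
      have h := ih h1.2 fun Y hY => h2 Y (List.mem_cons_of_mem _ hY)
      have hX := h2 X List.mem_cons_self (h1.1 P h hPv')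
      refine subset_diff_covered.2 ⟨hPS.trans hSC, fun Y hY => ?_⟩
      rcases List.mem_cons.1 hY with rfl | hY
      · exact hX
      · exact (subset_diff_covered.1 h).2 Y hY
  exact ⟨P, key O hch hP, htt.le.trans hPv'⟩

/-- The greedy procedure: the smallest square that is acceptable to some waiting agent is given to
that agent. -/
lemma exists_partial_allocation {C : Set Plane} (hC : IsCompact C) {n : ℕ} {g : Fin n → Plane → ℝ}
    (hg : ∀ i, Integrable (g i)) (hg0 : ∀ i, 0 ≤ g i) {t : Fin n → ℝ} (ht : ∀ i, 0 < t i)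
    (hS : ∀ i, ∃ S, sq S ⊆ C ∧ t i * (16 * n - 14) < value (g i) (sq S)) (m : ℕ) (hm : m ≤ n) :
    ∃ (A : Finset (Fin n)) (X : Fin n → Plane × ℝ × ℝ) (O : List (Plane × ℝ × ℝ)),
      A.card = m ∧ O.length = m ∧ (∀ Y, Y ∈ O ↔ ∃ i ∈ A, X i = Y) ∧
      (∀ i ∈ A, sq (X i) ⊆ C ∧ t i ≤ value (g i) (sq (X i))) ∧
      (∀ i ∈ A, ∀ j ∈ A, i ≠ j → Disjoint (sq (X i)) (sq (X j))) ∧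
      ∀ j ∉ A, IsChain C (g j) (t j) 0 O := by
  classical
  induction m with
  | zero => exact ⟨∅, fun _ => (0, 0, 0), [], by simp, rfl, by simp, by simp, by simp,
      fun _ _ => trivial⟩
  | succ m ih =>
    obtain ⟨A, X, O, hA, hOl, hmem, hX, hdis, hch⟩ := ih (by omega)
    have hpos : ∀ Y ∈ O, 0 < Y.2.1 := by
      intro Y hY
      obtain ⟨i, hi, rfl⟩ := (hmem Y).1 hY
      exact side_pos_of_value_pos ((ht i).trans_le (hX i hi).2)
    have hmin : ∀ j ∉ A, ∃ q, sq q ⊆ C \ covered O ∧ t j ≤ value (g j) (sq q) ∧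
        ∀ q', sq q' ⊆ C \ covered O → t j ≤ value (g j) (sq q') → q.2.1 ≤ q'.2.1 := by
      intro j hj
      refine exists_min_side hC Set.sdiff_subset (hg j) (ht j) ?_
      obtain ⟨S, hSC, hSv⟩ := hS j
      refine (hch j hj).exists_available hC (hg j) (hg0 j) (ht j) hpos hSC (lt_of_le_of_lt ?_ hSv)
      refine mul_le_mul_of_nonneg_left ?_ (ht j).le
      have : ((m : ℝ) + 1) ≤ n := by exact_mod_cast hm
      rw [hOl]
      linarith
    choose! q hq1 hq2 hq3 using hmin
    have hne : (Finset.univ \ A).Nonempty := by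
      rw [← Finset.card_pos, Finset.card_sdiff_of_subset (Finset.subset_univ A), Finset.card_univ,
        Fintype.card_fin]
      omega
    obtain ⟨j, hj, hjmin⟩ := Finset.exists_min_image _ (fun j => (q j).2.1) hne
    have hjA : j ∉ A := by simpa using hj
    have hup : ∀ i ∈ A, Function.update X j (q j) i = X i := fun i hi =>
      Function.update_of_ne (ne_of_mem_of_not_mem hi hjA) _ _
    have hqj := subset_diff_covered.1 (hq1 j hjA)
    refine ⟨insert j A, Function.update X j (q j), q j :: O, ?_, by simp [hOl], ?_, ?_, ?_, ?_⟩
    · rw [Finset.card_insert_of_notMem hjA, hA]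
    · intro Y
      rw [List.mem_cons, hmem, Finset.exists_mem_insert, Function.update_self, eq_comm]
      refine or_congr_right (exists_congr fun i => and_congr_right fun hi => ?_)
      rw [hup i hi]
    · intro i hi
      rcases Finset.mem_insert.1 hi with rfl | hi
      · rw [Function.update_self]
        exact ⟨hqj.1, hq2 i hjA⟩
      · rw [hup i hi]
        exact hX i hi
    · intro i hi' k hk' hik
      rcases Finset.mem_insert.1 hi' with rfl | hi <;> rcases Finset.mem_insert.1 hk' with rfl | hk
      · exact (hik rfl).elim
      · rw [Function.update_self, hup k hk]
        exact hqj.2 _ ((hmem _).2 ⟨k, hk, rfl⟩)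
      · rw [Function.update_self, hup i hi]
        exact (hqj.2 _ ((hmem _).2 ⟨i, hi, rfl⟩)).symm
      · rw [hup i hi, hup k hk]
        exact hdis i hi k hk hik
    · intro k hk
      rw [Finset.mem_insert, not_or] at hk
      refine ⟨fun r h1 h2 => ?_, hch k hk.2⟩
      have := hjmin k (by simpa using hk.2)
      linarith [hq3 k hk.2 r h1 h2]

lemma exists_allocation {C : Set Plane} (hC : IsCompact C) {n : ℕ} {g : Fin n → Plane → ℝ}
    (hg : ∀ i, Integrable (g i)) (hg0 : ∀ i, 0 ≤ g i) {t : Fin n → ℝ} (ht : ∀ i, 0 < t i)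
    (hS : ∀ i, ∃ S, sq S ⊆ C ∧ t i * (16 * n - 14) < value (g i) (sq S)) :
    ∃ X : Fin n → Plane × ℝ × ℝ, (∀ i, sq (X i) ⊆ C ∧ t i ≤ value (g i) (sq (X i))) ∧
      Pairwise fun i j => Disjoint (sq (X i)) (sq (X j)) := by
  obtain ⟨A, X, O, hA, -, -, hX, hdis, -⟩ := exists_partial_allocation hC hg hg0 ht hS n le_rfl
  have hA : A = Finset.univ := Finset.eq_univ_of_card A (by rw [hA, Fintype.card_fin])
  exact ⟨X, fun i => hX i (hA ▸ Finset.mem_univ i), fun i j =>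
    hdis i (hA ▸ Finset.mem_univ i) j (hA ▸ Finset.mem_univ j)⟩

/-- The thresholds may be attained: allocations for slightly smaller thresholds have a limit. -/
lemma exists_allocation_limit {C : Set Plane} (hC : IsCompact C) {n : ℕ} {g : Fin n → Plane → ℝ}
    (hg : ∀ i, Integrable (g i)) (hg0 : ∀ i, 0 ≤ g i) {t : Fin n → ℝ} (ht : ∀ i, 0 < t i)
    (hS : ∀ i, ∀ c < 1, ∃ S, sq S ⊆ C ∧ c * t i * (16 * n - 14) < value (g i) (sq S)) :
    ∃ X : Fin n → Plane × ℝ × ℝ, (∀ i, sq (X i) ⊆ C ∧ t i ≤ value (g i) (sq (X i))) ∧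
      Pairwise fun i j => Disjoint (sq (X i)) (sq (X j)) := by
  have hm : ∀ m : ℕ, ∃ X : Fin n → Plane × ℝ × ℝ, (∀ i, X i ∈ box C ∧ sq (X i) ⊆ C ∧
      (1 - 1 / ((m : ℝ) + 2)) * t i ≤ value (g i) (sq (X i))) ∧
      Pairwise fun i j => Disjoint (sq (X i)) (sq (X j)) := by
    intro m
    have h2 : (1 : ℝ) / (m + 2) < 1 := by
      rw [div_lt_one (by positivity)]
      have : (0 : ℝ) ≤ m := Nat.cast_nonneg m
      linarith
    have h3 : (0 : ℝ) < 1 / (m + 2) := by positivity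
    have hc : ∀ i, 0 < (1 - 1 / ((m : ℝ) + 2)) * t i := fun i => mul_pos (by linarith) (ht i)
    obtain ⟨X, hX, hd⟩ := exists_allocation hC hg hg0 hc fun i => hS i _ (by linarith)
    choose Y hY1 _ hY2 using fun i =>
      exists_mem_box hC (side_pos_of_value_pos ((hc i).trans_le (hX i).2)) (hX i).1
    refine ⟨Y, fun i => ⟨hY1 i, ?_, ?_⟩, fun i j hij => ?_⟩
    · rw [hY2 i]
      exact (hX i).1
    · rw [hY2 i]
      exact (hX i).2
    · change Disjoint (sq (Y i)) (sq (Y j))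
      rw [hY2 i, hY2 j]
      exact hd hij
  choose X hX hd using hm
  have hcomp : IsCompact (Set.univ.pi fun _ : Fin n => box C) :=
    isCompact_univ_pi fun _ => isCompact_box hC
  obtain ⟨Y, -, φ, hφ, hlim⟩ := hcomp.tendsto_subseq (x := X) fun m i _ => (hX m i).1
  have hi : ∀ i, Tendsto (fun m => X (φ m) i) atTop (𝓝 (Y i)) := fun i =>
    (tendsto_pi_nhds.1 hlim) i
  refine ⟨Y, fun i => ⟨?_, ?_⟩, fun i j hij => ?_⟩
  · exact (isClosed_setOf_sq_subset C).mem_of_tendsto (hi i)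
      (Eventually.of_forall fun m => (hX (φ m) i).2.1)
  · have h1 : Tendsto (fun m : ℕ => (1 - 1 / ((m : ℝ) + 2)) * t i) atTop (𝓝 ((1 - 0) * t i)) := by
      refine (tendsto_const_nhds.sub ?_).mul_const _
      exact tendsto_const_nhds.div_atTop
        (tendsto_atTop_add_const_right _ _ tendsto_natCast_atTop_atTop)
    rw [sub_zero, one_mul] at h1
    exact le_of_tendsto_of_tendsto' (h1.comp hφ.tendsto_atTop)
      (((continuous_value_sq (hg i)).tendsto (Y i)).comp (hi i)) fun m => (hX (φ m) i).2.2
  · exact isClosed_setOf_disjoint_sq.mem_of_tendsto ((hi i).prodMk_nhds (hi j))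
      (Eventually.of_forall fun m => hd (φ m) hij)

/-! ### The relative proportionality level -/

lemma mem_squares {X : Set Plane} : X ∈ squares ↔ ∃ q : Plane × ℝ × ℝ, 0 < q.2.1 ∧ X = sq q :=
  ⟨fun ⟨p, a, θ, ha, h⟩ => ⟨(p, a, θ), ha, h⟩, fun ⟨q, hq, h⟩ => ⟨q.1, q.2.1, q.2.2, hq, h⟩⟩

/-- The guarantee for densities on the whole plane for which all agents can get a positive
utility. -/
lemma exists_isAllocation_of_utility_pos {C : Set Plane} (hC : IsCompact C) {n : ℕ} (hn : 1 ≤ n)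
    {g : Fin n → Plane → ℝ} (hg : ∀ i, Integrable (g i)) (hg0 : ∀ i, 0 ≤ g i)
    (hU : ∀ i, 0 < utility squares (g i) C) :
    ∃ X : Fin n → Set Plane, IsAllocation C n squares X ∧
      ∀ i, 1 / (16 * (n : ℝ) - 14) * utility squares (g i) C ≤ value (g i) (X i) := by
  have hn' : (0 : ℝ) < 16 * n - 14 := by
    have : (1 : ℝ) ≤ n := by exact_mod_cast hn
    linarith
  have ht : ∀ i, 0 < 1 / (16 * (n : ℝ) - 14) * utility squares (g i) C := fun i =>
    mul_pos (one_div_pos.2 hn') (hU i)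
  obtain ⟨X, hX, hd⟩ := exists_allocation_limit hC hg hg0 ht fun i c hc => by
    have hlt : c * utility squares (g i) C < utility squares (g i) C := by
      nlinarith [hU i]
    have hne : {r | ∃ s ∈ squares, s ⊆ C ∧ r = value (g i) s}.Nonempty := by
      by_contra hempty
      have := hU i
      rw [utility, Set.not_nonempty_iff_eq_empty.1 hempty, Real.sSup_empty] at this
      exact lt_irrefl _ this
    obtain ⟨r, ⟨s, hs, hsC, rfl⟩, hr⟩ := exists_lt_of_lt_csSup hne hlt
    obtain ⟨q, -, rfl⟩ := mem_squares.1 hs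
    refine ⟨q, hsC, ?_⟩
    have e : c * (1 / (16 * (n : ℝ) - 14) * utility squares (g i) C) * (16 * n - 14) =
        c * utility squares (g i) C := by
      rw [mul_assoc, mul_right_comm, one_div_mul_cancel hn'.ne', one_mul]
    rwa [e]
  exact ⟨fun i => sq (X i), ⟨fun i => mem_squares.2
    ⟨X i, side_pos_of_value_pos ((ht i).trans_le (hX i).2), rfl⟩, fun i => (hX i).1, hd⟩,
    fun i => (hX i).2⟩

lemma value_indicator {C X : Set Plane} (hC : MeasurableSet C) (h : X ⊆ C) (v : Plane → ℝ) :
    value (C.indicator v) X = value v X := by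
  rw [value, setIntegral_indicator hC, Set.inter_eq_left.2 h, value]

lemma utility_indicator {C : Set Plane} (hC : MeasurableSet C) (v : Plane → ℝ) :
    utility squares (C.indicator v) C = utility squares v C := by
  unfold utility
  congr 1
  ext r
  refine exists_congr fun s => and_congr_right fun _ => and_congr_right fun h => ?_
  rw [value_indicator hC h]

/-- For the area as value, the cake has positive utility. -/
lemma utility_indicator_one_pos {C : Set Plane} (hC : IsCompact C)
    (hsq : ∃ s ∈ squares, s ⊆ C) : 0 < utility squares (C.indicator 1) C := by
  have hi : Integrable (C.indicator (1 : Plane → ℝ)) :=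
    (integrable_indicator_iff hC.measurableSet).2 (integrableOn_const hC.measure_ne_top)
  obtain ⟨s, hs, hsC⟩ := hsq
  obtain ⟨q, hq, rfl⟩ := mem_squares.1 hs
  have hb : BddAbove {r | ∃ s ∈ squares, s ⊆ C ∧ r = value (C.indicator 1) s} := by
    refine ⟨∫ x, C.indicator 1 x, ?_⟩
    rintro _ ⟨s, -, -, rfl⟩
    exact setIntegral_le_integral hi
      (Filter.Eventually.of_forall fun x => Set.indicator_nonneg (fun _ _ => zero_le_one) x)
  refine lt_of_lt_of_le ?_ (le_csSup hb ⟨_, hs, hsC, rfl⟩)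
  rw [value_indicator hC.measurableSet hsC, value]
  have hne : (sq q).Nonempty := by
    refine ⟨framePt q.1 q.2.2 (q.2.1 / 2) (q.2.1 / 2), ?_⟩
    rw [mem_sq, cX_framePt, cY_framePt]
    exact ⟨⟨by linarith, by linarith⟩, by linarith, by linarith⟩
  have hfin : volume (sq q) ≠ ⊤ := measure_ne_top_of_subset hsC hC.measure_ne_top
  simp only [Pi.one_apply, setIntegral_const, smul_eq_mul, mul_one]
  exact ENNReal.toReal_pos ((isOpen_sq q).measure_pos volume hne).ne' hfin

theorem isGuaranteedRel_squares {C : Set Plane} (hC : IsCompact C) (hsq : ∃ s ∈ squares, s ⊆ C)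
    {n : ℕ} (hn : 1 ≤ n) : IsGuaranteedRel C n squares (1 / (16 * (n : ℝ) - 14)) := by
  classical
  intro v hv
  have hCm : MeasurableSet C := hC.measurableSet
  -- An agent for whom all squares are worthless is treated as if interested in the area.
  let w : Fin n → Plane → ℝ := fun i => if 0 < utility squares (v i) C then v i else 1
  have hw0 : ∀ i, ∀ x ∈ C, 0 ≤ w i x := by
    intro i x hx
    by_cases h : 0 < utility squares (v i) C
    · simp only [w, if_pos h]
      exact (hv i).nonneg x hx
    · simp only [w, if_neg h]
      exact zero_le_one
  have hwi : ∀ i, IntegrableOn (w i) C := by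
    intro i
    by_cases h : 0 < utility squares (v i) C
    · simp only [w, if_pos h]
      exact (hv i).integrableOn
    · simp only [w, if_neg h]
      exact integrableOn_const hC.measure_ne_top
  have hwU : ∀ i, 0 < utility squares (C.indicator (w i)) C := by
    intro i
    by_cases h : 0 < utility squares (v i) C
    · simp only [w, if_pos h]
      rwa [utility_indicator hCm]
    · simp only [w, if_neg h]
      exact utility_indicator_one_pos hC hsq
  obtain ⟨X, hX, hval⟩ := exists_isAllocation_of_utility_pos hC hn
    (fun i => (integrable_indicator_iff hCm).2 (hwi i))
    (fun i x => Set.indicator_nonneg (hw0 i) x) hwU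
  refine ⟨X, hX, fun i => ?_⟩
  by_cases h : 0 < utility squares (v i) C
  · have := hval i
    rw [utility_indicator hCm, value_indicator hCm (hX.subset i)] at this
    simpa only [w, if_pos h] using this
  · have hn' : (1 : ℝ) ≤ n := by exact_mod_cast hn
    refine (mul_nonpos_of_nonneg_of_nonpos (one_div_nonneg.2 (by linarith)) (not_lt.1 h)).trans ?_
    obtain ⟨q, -, hq⟩ := mem_squares.1 (hX.mem i)
    refine setIntegral_nonneg ?_ fun x hx => (hv i).nonneg x (hX.subset i hx)
    rw [hq]
    exact (isOpen_sq q).measurableSet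

end CakeCutting

theorem mainTheorem9 (C : Set CakeCutting.Plane) (hC : IsCompact C)
    (hsq : ∃ s ∈ CakeCutting.squares, s ⊆ C) (n : ℕ) (hn : 1 ≤ n) :
    CakeCutting.IsGuaranteedRel C n CakeCutting.squares (1 / (16 * (n : ℝ) - 14)) ∧
      1 / (16 * (n : ℝ) - 14) ≤ CakeCutting.propRel C n CakeCutting.squares := by
  have h := CakeCutting.isGuaranteedRel_squares hC hsq hn
  have hn' : (1 : ℝ) ≤ n := by exact_mod_cast hn
  refine ⟨h, le_csSup ⟨1, fun f hf => hf.1.2⟩ ⟨⟨one_div_nonneg.2 (by linarith), ?_⟩, h⟩⟩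
  rw [div_le_one (by linarith)]
  linarith
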